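/- Let $\mathbb S=\{z\in\mathbb C:|z|=1\}$ and let $C(\mathbb S,\mathbb C)$ be the algebra of continuous functions $\mathbb S\to\mathbb C$. A continuous inverse algebra (cia) is a locally convex Hausdorff unital associative complex topological algebra (with jointly continuous multiplication) whose unit group is open and whose inversion is continuous on the unit group. A cia (respectively, a Banach algebra) $\mathcal A\subseteq C(\mathbb S,\mathbb C)$, with its own topology, is called an $R$-cia (respectively, an $R$-algebra) if the restrictions to $\mathbb S$ of all rational functions with poles off $\mathbb S$ lie in $\mathcal A$ and form a dense subset of it. Let $\mathcal A^+$ and $\mathcal A^{\ominus}$ be the closures in $\mathcal A$ of $\mathbb C[z]$ and of $z^{-1}\mathbb C[z^{-1}]$, respectively, and let $\mathcal A^-:=\mathcal A^{\ominus}+\mathbb C\mathbf 1$. One calls $\mathcal A$ decomposing if $\mathcal A=\mathcal A^+\oplus\mathcal A^{\ominus}$ as a topological vector space. A locally convex space $E$ is Mackey complete if every Mackey–Cauchy sequence in $E$ converges; here a sequence $(x_m)$ is Mackey–Cauchy if there are a bounded set $B\subseteq E$ and real numbers $\mu_{m,k}$, tending to $0$ as $m,k\to\infty$, with $x_m-x_k\in\mu_{m,k}B$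 for all $m,k$. **Proposition.** Let $\mathcal A$ be a decomposing $R$-algebra. Then each $g\in \mathrm{GL}_n(\mathcal A)$ can be written in the form $$g=g_+\,D\,g_-$$ where $g_+\in \mathrm{GL}_n(\mathcal A^+)$, $g_-\in\mathrm{GL}_n(\mathcal A^-)$ and $D(z)=\mathrm{diag}(z^{\kappa_1},\ldots,z^{\kappa_n})$ with integers $\kappa_1\ge\kappa_2\ge\cdots\ge\kappa_n$. The $n$-tuple $(\kappa_1,\ldots,\kappa_n)$ of partial indices is uniquely determined by $g$. The same conclusion holds if $\mathcal A$ is any Mackey complete, decomposing $R$-cia such that $\mathrm{GL}_n(\mathcal A^+)\,\mathrm{GL}_n(\mathcal A^-)$ is an identity neighbourhood in $\mathrm{GL}_n(\mathcal A)$. -/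

import Mathlib

open scoped Topology

noncomputable section

namespace Birkhoff

/-- The function `z ↦ z ^ k` on the unit circle, for an integer `k`. -/
def zPow (k : ℤ) : C(Circle, ℂ) where
  toFun z := (z : ℂ) ^ k
  continuous_toFun := by
    have h : Continuous fun z : Circle => ((z ^ k : Circle) : ℂ) :=
      continuous_subtype_val.comp (continuous_zpow k)
    simpa using h

/-- Restrictions to the unit circle of the rational functions with poles off the circle. -/
def rationalFunctions : Set C(Circle, ℂ) :=
  {f | ∃ p q : Polynomial ℂ, (∀ z : Circle, q.eval (z : ℂ) ≠ 0) ∧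
    ∀ z : Circle, f z = p.eval (z : ℂ) / q.eval (z : ℂ)}

/-- The polynomial functions `ℂ[z]` on the circle. -/
def polynomialFunctions : Submodule ℂ C(Circle, ℂ) :=
  Submodule.span ℂ (Set.range fun k : ℕ => zPow (k : ℤ))

/-- The space `z⁻¹ ℂ[z⁻¹]` of functions on the circle. -/
def negPolynomialFunctions : Submodule ℂ C(Circle, ℂ) :=
  Submodule.span ℂ (Set.range fun k : ℕ => zPow (-((k : ℤ) + 1)))

/-- A continuous inverse algebra: a locally convex Hausdorff complex topological algebra with
jointly continuous multiplication whose unit group is open and whose inversion is continuous on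
the unit group; `IsOpenUnits` says the latter two things. (Only commutative algebras are needed here.) -/
class IsCIA (A : Type*) [CommRing A] [Algebra ℂ A] [TopologicalSpace A] : Prop
    extends IsTopologicalRing A, ContinuousSMul ℂ A, T2Space A, LocallyConvexSpace ℝ A,
      IsOpenUnits A

/-- A sequence is Mackey-Cauchy if its differences `x m - x k` lie in `μ (m, k) • B` for some
bounded set `B` and scalars `μ (m, k)` that tend to zero as `m, k → ∞`. -/
def IsMackeyCauchy {E : Type*} [AddCommGroup E] [Module ℂ E] [TopologicalSpace E]
    (x : ℕ → E) : Prop :=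
  ∃ B : Set E, Bornology.IsVonNBounded ℂ B ∧ ∃ μ : ℕ × ℕ → ℝ,
    Filter.Tendsto μ Filter.atTop (𝓝 0) ∧
      ∀ m k : ℕ, ∃ b ∈ B, x m - x k = (μ (m, k) : ℂ) • b

/-- Every Mackey-Cauchy sequence converges. -/
def IsMackeyComplete (E : Type*) [AddCommGroup E] [Module ℂ E] [TopologicalSpace E] : Prop :=
  ∀ x : ℕ → E, IsMackeyCauchy x → ∃ l : E, Filter.Tendsto x Filter.atTop (𝓝 l)

section

variable {A : Type*} [CommRing A] [Algebra ℂ A] [TopologicalSpace A]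

/-- The algebra `A`, with its own topology, is of type `R`. Here `A` is regarded as a subalgebra
of `C(Circle, ℂ)` through the injective homomorphism `ι`; no continuity of `ι` is assumed. The
rational functions with poles off the circle have to lie in `A` and be dense there. -/
structure IsTypeR (ι : A →ₐ[ℂ] C(Circle, ℂ)) : Prop where
  injective : Function.Injective ι
  rational_mem : rationalFunctions ⊆ Set.range ι
  dense_rational : Dense (ι ⁻¹' rationalFunctions)

variable [IsTopologicalRing A] [ContinuousSMul ℂ A]

/-- `A⁺`, the closure of `ℂ[z]` in `A`. -/
def plus (ι : A →ₐ[ℂ] C(Circle, ℂ)) : Submodule ℂ A :=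
  (polynomialFunctions.comap ι.toLinearMap).topologicalClosure

/-- `A^⊖`, the closure of `z⁻¹ ℂ[z⁻¹]` in `A`. -/
def ominus (ι : A →ₐ[ℂ] C(Circle, ℂ)) : Submodule ℂ A :=
  (negPolynomialFunctions.comap ι.toLinearMap).topologicalClosure

/-- `A⁻ = A^⊖ + ℂ 1`. -/
def minus (ι : A →ₐ[ℂ] C(Circle, ℂ)) : Submodule ℂ A :=
  ominus ι ⊔ Submodule.span ℂ {1}

/-- `A = A⁺ ⊕ A^⊖` as a topological vector space: `A⁺` and `A^⊖` are algebraic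
complements and the projections are continuous. -/
def IsDecomposing (ι : A →ₐ[ℂ] C(Circle, ℂ)) : Prop :=
  (plus ι).IsTopCompl (ominus ι)

end

section

variable {A : Type*} [CommRing A] [Algebra ℂ A]

/-- `GL_n(S)` inside `GL_n(A)`, for a subspace `S` of `A` (used for the subalgebras
`S = A⁺` and `S = A⁻`): the invertible matrices with entries in `S` whose inverse has entries
in `S`. -/
def GLOver (n : ℕ) (S : Submodule ℂ A) : Set (GL (Fin n) A) :=
  {g | ∀ i j, (g : Matrix (Fin n) (Fin n) A) i j ∈ S ∧
    ((g⁻¹ : GL (Fin n) A) : Matrix (Fin n) (Fin n) A) i j ∈ S}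

variable [TopologicalSpace A] [IsTopologicalRing A] [ContinuousSMul ℂ A]

/-- `g = g₊ D g₋` with `g₊ ∈ GL_n(A⁺)`, `g₋ ∈ GL_n(A⁻)` and
`D(z) = diag(z ^ κ₁, …, z ^ κₙ)`. -/
def FactorsWith {n : ℕ} (ι : A →ₐ[ℂ] C(Circle, ℂ)) (g : GL (Fin n) A) (κ : Fin n → ℤ) : Prop :=
  ∃ gp ∈ GLOver n (plus ι), ∃ gm ∈ GLOver n (minus ι), ∃ D : Matrix (Fin n) (Fin n) A,
    D.map ι = Matrix.diagonal (fun i => zPow (κ i)) ∧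
      (g : Matrix (Fin n) (Fin n) A) = gp * D * gm

/-- Every `g ∈ GL_n(A)` has a factorization `g = g₊ D g₋` with partial indices
`κ₁ ≥ ⋯ ≥ κₙ`, and the tuple of partial indices is unique. -/
def HasBirkhoffFactorization (n : ℕ) (ι : A →ₐ[ℂ] C(Circle, ℂ)) : Prop :=
  ∀ g : GL (Fin n) A, ∃! κ : Fin n → ℤ, Antitone κ ∧ FactorsWith ι g κ

/-- `GL_n(A⁺) GL_n(A⁻)` is an identity neighbourhood in the topological group `GL_n(A)`. -/
def ProductIsIdentityNhd (n : ℕ) (ι : A →ₐ[ℂ] C(Circle, ℂ)) : Prop :=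
  {g : GL (Fin n) A | ∃ gp ∈ GLOver n (plus ι), ∃ gm ∈ GLOver n (minus ι), g = gp * gm} ∈
    𝓝 (1 : GL (Fin n) A)

end

end Birkhoff

end

noncomputable section

namespace Birkhoff

open Metric Filter

/-! Openness of the unit group makes `ι` continuous, so elements of A⁺ and A⁻ extend holomorphically
to the disc and to its exterior. For a decomposing algebra the converse holds too, because a
function extending to both sides is constant (`mem_plus_iff`, `mem_minus_iff`). The factorization
can therefore be studied over the algebras `plusAlg` and `minusAlg` of extendable functions.

Existence. Laurent polynomials are dense, so some invertible Laurent matrix r satisfies g r⁻¹ = g₊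
g₋, by the neighbourhood hypothesis. With r = z^N q(z⁻¹) for a polynomial matrix q, it remains to
factor g₋ q, a matrix over `minusAlg` whose determinant is a polynomial p in z⁻¹ times a unit.
`factors_of_det_eq` removes the roots w of p one by one. A root with |w| > 1 gives a unit of
`minusAlg`, and |w| = 1 contradicts invertibility. If |w| < 1, the matrix is singular at z⁻¹ = w, so
some constant combination of rows is divisible by z⁻¹ - w. After division and induction, the factor
z⁻¹ - w = (1 - wz) z⁻¹ has to be put back into one row. Here 1 - wz is a unit of `plusAlg`, and
`Factors.shift` carries z⁻¹ through g₊ into D.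

Uniqueness. From X D = D' Y with X over `plusAlg` and Y over `minusAlg`, an exponent of D exceeding
its counterpart in D' would force a block of zeros in X large enough to make X singular.

In a Banach algebra the neighbourhood hypothesis comes from the inverse function theorem applied to
x ↦ (1 + p x)(1 + q x), where p and q are the projections onto A⁺ and A^⊖. -/

/-! ### Holomorphic extension to the disc and to its exterior. -/

/-- The disc algebra: continuous functions on the circle that extend holomorphically to the
open unit disc. -/
def discAlgebra : Subalgebra ℂ C(Circle, ℂ) where
  carrier := {f | ∃ F : ℂ → ℂ, DiffContOnCl ℂ F (ball 0 1) ∧ ∀ z : Circle, f z = F z}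
  mul_mem' := by
    rintro f g ⟨F, hF, hf⟩ ⟨G, hG, hg⟩
    exact ⟨fun z => F z * G z, hF.smul hG, fun z => by simp [hf, hg]⟩
  add_mem' := by
    rintro f g ⟨F, hF, hf⟩ ⟨G, hG, hg⟩
    exact ⟨F + G, hF.add hG, fun z => by simp [hf, hg]⟩
  algebraMap_mem' c := ⟨fun _ => c, diffContOnCl_const, fun z => by simp⟩

theorem eqOn_closedBall_of_eq_circle {F G : ℂ → ℂ} (hF : DiffContOnCl ℂ F (ball 0 1))
    (hG : DiffContOnCl ℂ G (ball 0 1)) (h : ∀ z : Circle, F z = G z) :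
    Set.EqOn F G (closedBall 0 1) := by
  rw [← closure_ball (0 : ℂ) one_ne_zero]
  refine Complex.eqOn_closure_of_eqOn_frontier isBounded_ball hF hG ?_
  rw [frontier_ball _ one_ne_zero]
  intro z hz
  exact h ⟨z, mem_sphere_zero_iff_norm.2 (by simpa using hz)⟩

/-- The extension of a function in the disc algebra. -/
def discExt (f : discAlgebra) : ℂ → ℂ := f.2.choose

theorem discExt_diffContOnCl (f : discAlgebra) : DiffContOnCl ℂ (discExt f) (ball 0 1) :=
  f.2.choose_spec.1

theorem discExt_circle (f : discAlgebra) (z : Circle) : discExt f z = f.1 z :=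
  (f.2.choose_spec.2 z).symm

theorem discExt_eq {f : discAlgebra} {F : ℂ → ℂ} (hF : DiffContOnCl ℂ F (ball 0 1))
    (h : ∀ z : Circle, f.1 z = F z) : Set.EqOn (discExt f) F (closedBall 0 1) :=
  eqOn_closedBall_of_eq_circle (discExt_diffContOnCl f) hF fun z => by rw [discExt_circle, h]

/-- Evaluation of elements of the disc algebra at a point of the open disc. -/
def discEval (w : ball (0 : ℂ) 1) : discAlgebra →ₐ[ℂ] ℂ where
  toFun f := discExt f w
  map_one' := discExt_eq (F := fun _ => 1) diffContOnCl_const (fun _ => rfl)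
    (ball_subset_closedBall w.2)
  map_zero' := discExt_eq (F := fun _ => 0) diffContOnCl_const (fun _ => rfl)
    (ball_subset_closedBall w.2)
  map_mul' f g := discExt_eq (F := fun z => discExt f z * discExt g z)
    ((discExt_diffContOnCl f).smul (discExt_diffContOnCl g))
    (fun z => by simp [discExt_circle]) (ball_subset_closedBall w.2)
  map_add' f g := discExt_eq (F := fun z => discExt f z + discExt g z)
    ((discExt_diffContOnCl f).add (discExt_diffContOnCl g))
    (fun z => by simp [discExt_circle]) (ball_subset_closedBall w.2)
  commutes' c := discExt_eq (F := fun _ => c) diffContOnCl_const (fun _ => rfl)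
    (ball_subset_closedBall w.2)

theorem discEval_eq {w : ball (0 : ℂ) 1} {f : discAlgebra} {F : ℂ → ℂ}
    (hF : DiffContOnCl ℂ F (ball 0 1)) (h : ∀ z : Circle, f.1 z = F z) : discEval w f = F w :=
  discExt_eq hF h (ball_subset_closedBall w.2)

/-- A function of the disc algebra that vanishes at `w` is divisible by `z - w`. -/
theorem div_mem_discAlgebra {w : ball (0 : ℂ) 1} {f : discAlgebra} (hf : discEval w f = 0)
    {g : C(Circle, ℂ)} (hg : ∀ z : Circle, ((z : ℂ) - w) * g z = f.1 z) : g ∈ discAlgebra := by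
  have hw : closedBall (0 : ℂ) 1 ∈ 𝓝 (w : ℂ) :=
    mem_of_superset (isOpen_ball.mem_nhds w.2) ball_subset_closedBall
  -- The slope function has a removable singularity at the zero w.
  refine ⟨dslope (discExt f) w, DiffContOnCl.mk_ball
    ((Complex.differentiableOn_dslope (isOpen_ball.mem_nhds w.2)).2
      (discExt_diffContOnCl f).differentiableOn)
    ((continuousOn_dslope hw).2 ⟨(discExt_diffContOnCl f).continuousOn_ball,
      (discExt_diffContOnCl f).differentiableAt isOpen_ball w.2⟩), fun z => ?_⟩
  have hne : (z : ℂ) ≠ w := by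
    rintro h
    have := w.2
    rw [← h] at this
    simp [Circle.norm_coe] at this
  rw [dslope_of_ne _ hne, slope_def_field, discExt_circle, ← hg z]
  change discExt f w = 0 at hf
  rw [hf]
  field_simp [sub_ne_zero.2 hne]
  simp

/-- By the maximum principle, uniform convergence on the circle passes to the extensions on the
closed disc, and locally uniform limits of holomorphic functions are holomorphic. -/
theorem isClosed_discAlgebra : IsClosed (discAlgebra : Set C(Circle, ℂ)) := by
  refine isClosed_of_closure_subset fun f hf => ?_
  obtain ⟨u, hu, hlim⟩ := mem_closure_iff_seq_limit.1 hf
  set F : ℕ → ℂ → ℂ := fun k => discExt ⟨u k, hu k⟩ with hF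
  have hd : ∀ k, DiffContOnCl ℂ (F k) (ball 0 1) := fun k => discExt_diffContOnCl _
  have hb : ∀ k l, ∀ z ∈ closedBall (0 : ℂ) 1, ‖F k z - F l z‖ ≤ ‖u k - u l‖ := by
    intro k l z hz
    refine Complex.norm_le_of_forall_mem_frontier_norm_le (U := ball (0 : ℂ) 1) isBounded_ball
      ((hd k).sub (hd l)) (fun y hy => ?_) (by rwa [closure_ball (0 : ℂ) one_ne_zero])
    rw [frontier_ball _ one_ne_zero] at hy
    have := (u k - u l).norm_coe_le_norm ⟨y, mem_sphere_zero_iff_norm.2 (by simpa using hy)⟩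
    have h1 := discExt_circle ⟨u k, hu k⟩ ⟨y, mem_sphere_zero_iff_norm.2 (by simpa using hy)⟩
    have h2 := discExt_circle ⟨u l, hu l⟩ ⟨y, mem_sphere_zero_iff_norm.2 (by simpa using hy)⟩
    change ‖u k _ - u l _‖ ≤ _ at this
    rw [← h1, ← h2] at this
    exact this
  have hc : UniformCauchySeqOn F atTop (closedBall 0 1) := by
    rw [Metric.uniformCauchySeqOn_iff]
    intro ε hε
    obtain ⟨N, hN⟩ := Metric.cauchySeq_iff.1 hlim.cauchySeq ε hε
    refine ⟨N, fun m hm k hk z hz => ?_⟩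
    rw [dist_eq_norm]
    refine (hb m k z hz).trans_lt ?_
    rw [← dist_eq_norm]
    exact hN m hm k hk
  have hex : ∀ z : ℂ, ∃ y, z ∈ closedBall (0 : ℂ) 1 → Tendsto (fun k => F k z) atTop (𝓝 y) := by
    intro z
    by_cases hz : z ∈ closedBall (0 : ℂ) 1
    · obtain ⟨y, hy⟩ := cauchySeq_tendsto_of_complete (hc.cauchySeq hz)
      exact ⟨y, fun _ => hy⟩
    · exact ⟨0, fun h => absurd h hz⟩
  choose G hG using hex
  have hun := hc.tendstoUniformlyOn_of_tendsto hG
  refine ⟨G, DiffContOnCl.mk_ball ?_ ?_, fun z => ?_⟩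
  · exact ((hun.mono ball_subset_closedBall).tendstoLocallyUniformlyOn).differentiableOn
      (Eventually.of_forall fun k => (hd k).differentiableOn) isOpen_ball
  · exact hun.continuousOn (Eventually.of_forall fun k => (hd k).continuousOn_ball).frequently
  · have h1 := hG z (by simp [Circle.norm_coe])
    have h2 : Tendsto (fun k => u k z) atTop (𝓝 (f z)) :=
      ((ContinuousEvalConst.continuous_eval_const z).tendsto f).comp hlim
    refine tendsto_nhds_unique h2 (h1.congr fun k => discExt_circle _ z)

/-- Composition with the inversion `z ↦ z⁻¹` of the circle. -/
def circleInv : C(Circle, ℂ) →ₐ[ℂ] C(Circle, ℂ) :=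
  ContinuousMap.compRightAlgHom ℂ ℂ ⟨fun z : Circle => z⁻¹, continuous_inv⟩

@[simp] theorem circleInv_apply (f : C(Circle, ℂ)) (z : Circle) : circleInv f z = f z⁻¹ := rfl

theorem continuous_circleInv : Continuous circleInv :=
  ContinuousMap.continuous_precomp _

/-- The functions that extend holomorphically to the exterior of the disc, including infinity. -/
def extAlgebra : Subalgebra ℂ C(Circle, ℂ) := discAlgebra.comap circleInv

theorem isClosed_extAlgebra : IsClosed (extAlgebra : Set C(Circle, ℂ)) :=
  isClosed_discAlgebra.preimage continuous_circleInv

/-- A function that extends holomorphically to both sides of the circle is constant. -/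
theorem eq_const_of_mem_disc_of_mem_ext (f : discAlgebra) (h2 : f.1 ∈ extAlgebra) (z : Circle) :
    f.1 z = discEval ⟨0, by simp⟩ f := by
  set c : ℂ := discEval ⟨0, by simp⟩ f with hc
  set F := discExt f with hF
  have hFd : DiffContOnCl ℂ F (ball 0 1) := discExt_diffContOnCl f
  obtain ⟨G, hGd, hG⟩ := h2
  have hF0 : F 0 = c := rfl
  -- Reflection turns the exterior extension into a function holomorphic in the disc with boundary
  -- values conj f.
  set H : ℂ → ℂ := fun y => starRingEnd ℂ (G (starRingEnd ℂ y)) with hH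
  have hHd : DiffContOnCl ℂ H (ball 0 1) := by
    refine DiffContOnCl.mk_ball (fun y hy => ?_) ?_
    · have h : DifferentiableAt ℂ G (starRingEnd ℂ y) :=
        hGd.differentiableAt isOpen_ball (by simpa using hy)
      have h' := h.conj_conj
      rw [Complex.conj_conj] at h'
      exact h'.differentiableWithinAt
    · refine Complex.continuous_conj.comp_continuousOn (hGd.continuousOn_ball.comp
        Complex.continuous_conj.continuousOn fun y hy => ?_)
      simpa using hy
  -- K is holomorphic, vanishes at 0 and equals |f - c|² on the circle; by the mean value property
  -- |f - c|² has mean zero.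
  set K : ℂ → ℂ := fun y => (F y - c) * (H y - starRingEnd ℂ c) with hK
  have hKd : DiffContOnCl ℂ K (ball 0 1) := (hFd.sub_const c).smul (hHd.sub_const _)
  have havg := DiffContOnCl.circleAverage (f := K) (c := 0) (R := 1) (by simpa using hKd)
  have hval : ∀ y : Circle, K y = ((‖f.1 y - c‖ ^ 2 : ℝ) : ℂ) := by
    intro y
    have h1 : H y = starRingEnd ℂ (f.1 y) := by
      have := hG y⁻¹
      change f.1 y⁻¹⁻¹ = _ at this
      rw [inv_inv, Circle.coe_inv_eq_conj] at this
      exact congrArg (starRingEnd ℂ) this.symm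
    simp only [hK, h1, hF, discExt_circle]
    rw [← map_sub, Complex.mul_conj, Complex.normSq_eq_norm_sq]
  have hmap : ∀ θ : ℝ, K (circleMap 0 1 θ) = ((‖f.1 (Circle.exp θ) - c‖ ^ 2 : ℝ) : ℂ) := by
    intro θ
    rw [← hval]
    simp [circleMap]
  have hK0 : K 0 = 0 := by simp [hK, hF0]
  rw [hK0, Real.circleAverage_def] at havg
  simp only [hmap] at havg
  rw [intervalIntegral.integral_ofReal] at havg
  have hint : ∫ θ in (0 : ℝ)..2 * Real.pi, ‖f.1 (Circle.exp θ) - c‖ ^ 2 = 0 := by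
    have := smul_eq_zero.1 havg
    rcases this with h | h
    · exact absurd h (by positivity)
    · exact_mod_cast h
  by_contra hne
  have hne' : 0 < ‖f.1 z - c‖ ^ 2 := by
    have := norm_pos_iff.2 (sub_ne_zero.2 hne)
    positivity
  have hcont : Continuous fun θ : ℝ => ‖f.1 (Circle.exp θ) - c‖ ^ 2 := by fun_prop
  obtain ⟨θ, hθ, hz⟩ : ∃ θ ∈ Set.Icc (0 : ℝ) (2 * Real.pi), Circle.exp θ = z := by
    obtain ⟨t, ht, hz⟩ := Circle.periodic_exp.exists_mem_Ico₀ Real.two_pi_pos (Complex.arg z)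
    exact ⟨t, ⟨ht.1, ht.2.le⟩, by rw [← hz, Circle.exp_arg]⟩
  have := intervalIntegral.integral_pos Real.two_pi_pos hcont.continuousOn
    (fun _ _ => by positivity) ⟨θ, hθ, by rw [hz]; exact hne'⟩
  exact this.ne' hint

/-! ### The coordinate function, and division by linear factors inside `A`. -/

section

variable {A : Type*} [CommRing A] [Algebra ℂ A]

/-- The elements of `A` that extend holomorphically to the disc. -/
def plusAlg (ι : A →ₐ[ℂ] C(Circle, ℂ)) : Subalgebra ℂ A := discAlgebra.comap ι

/-- The elements of `A` that extend holomorphically to the exterior of the disc. -/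
def minusAlg (ι : A →ₐ[ℂ] C(Circle, ℂ)) : Subalgebra ℂ A := extAlgebra.comap ι

/-- The value at `0`. -/
def evalZero (ι : A →ₐ[ℂ] C(Circle, ℂ)) : plusAlg ι →ₐ[ℂ] ℂ :=
  (discEval ⟨0, by simp⟩).comp ((ι.comp (plusAlg ι).val).codRestrict discAlgebra fun x => x.2)

/-- The value at the point `w⁻¹` of the exterior. -/
def evalExt (ι : A →ₐ[ℂ] C(Circle, ℂ)) (w : ball (0 : ℂ) 1) : minusAlg ι →ₐ[ℂ] ℂ :=
  (discEval w).comp (((circleInv.comp ι).comp (minusAlg ι).val).codRestrict discAlgebra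
    fun x => x.2)

theorem evalZero_eq {ι : A →ₐ[ℂ] C(Circle, ℂ)} {x : plusAlg ι} {F : ℂ → ℂ}
    (hF : DiffContOnCl ℂ F (ball 0 1)) (h : ∀ z : Circle, ι x z = F z) :
    evalZero ι x = F 0 :=
  discEval_eq hF h

theorem evalExt_eq {ι : A →ₐ[ℂ] C(Circle, ℂ)} {w : ball (0 : ℂ) 1} {x : minusAlg ι} {F : ℂ → ℂ}
    (hF : DiffContOnCl ℂ F (ball 0 1)) (h : ∀ z : Circle, ι x z⁻¹ = F z) :
    evalExt ι w x = F w :=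
  discEval_eq hF h

variable [TopologicalSpace A] {ι : A →ₐ[ℂ] C(Circle, ℂ)}

theorem IsTypeR.ext (h : IsTypeR ι) {x y : A} (hxy : ∀ z : Circle, ι x z = ι y z) : x = y :=
  h.injective (ContinuousMap.ext hxy)

theorem IsTypeR.exists_rational (h : IsTypeR ι) (p q : Polynomial ℂ)
    (hq : ∀ z : Circle, q.eval (z : ℂ) ≠ 0) :
    ∃ a : A, ∀ z : Circle, ι a z = p.eval (z : ℂ) / q.eval (z : ℂ) := by
  have hc : Continuous fun z : Circle => p.eval (z : ℂ) / q.eval (z : ℂ) :=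
    (p.continuous.comp continuous_subtype_val).div (q.continuous.comp continuous_subtype_val) hq
  obtain ⟨a, ha⟩ := h.rational_mem (show (⟨_, hc⟩ : C(Circle, ℂ)) ∈ rationalFunctions from ⟨p, q, hq, fun _ => rfl⟩)
  exact ⟨a, fun z => by rw [ha]; rfl⟩

theorem IsTypeR.exists_inv_linear (h : IsTypeR ι) (w : ℂ) (hw : ‖w‖ ≠ 1) :
    ∃ a : A, ∀ z : Circle, ι a z = (1 - w * z)⁻¹ := by
  obtain ⟨a, ha⟩ := h.exists_rational 1 (1 - Polynomial.C w * Polynomial.X) (fun z hz => by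
    simp only [Polynomial.eval_sub, Polynomial.eval_one, Polynomial.eval_mul, Polynomial.eval_C,
      Polynomial.eval_X] at hz
    have h1 : ‖w * z‖ = 1 := by rw [← sub_eq_zero.1 hz]; simp
    exact hw (by simpa [Circle.norm_coe] using h1))
  exact ⟨a, fun z => by rw [ha]; simp⟩

theorem one_sub_mul_ne_zero {w z : ℂ} (hw : ‖w‖ < 1) (hz : ‖z‖ ≤ 1) : 1 - w * z ≠ 0 := by
  intro h0
  have h1 : ‖w * z‖ = 1 := by rw [← sub_eq_zero.1 h0]; simp
  rw [norm_mul] at h1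
  nlinarith [norm_nonneg w, norm_nonneg z]

/-- The coordinate function `z` as a unit of `A`. -/
theorem IsTypeR.exists_coordinate (h : IsTypeR ι) :
    ∃ u : Aˣ, ∀ z : Circle, ι (u : A) z = z ∧ ι (↑u⁻¹ : A) z = (z : ℂ)⁻¹ := by
  obtain ⟨a, ha⟩ := h.exists_rational Polynomial.X 1 (by simp)
  obtain ⟨b, hb⟩ := h.exists_rational 1 Polynomial.X (by simp)
  have hab : a * b = 1 := h.ext fun z => by simp [ha, hb]
  exact ⟨⟨a, b, hab, by rw [mul_comm, hab]⟩, fun z => ⟨by simp [ha], by simp [hb]⟩⟩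

/-- The coordinate function `z` as a unit of `A`. -/
def IsTypeR.coord (h : IsTypeR ι) : Aˣ := h.exists_coordinate.choose

variable (h : IsTypeR ι)
include h

@[simp] theorem IsTypeR.coord_apply (z : Circle) : ι (h.coord : A) z = z :=
  (h.exists_coordinate.choose_spec z).1

@[simp] theorem IsTypeR.coord_inv_apply (z : Circle) : ι (↑h.coord⁻¹ : A) z = (z : ℂ)⁻¹ :=
  (h.exists_coordinate.choose_spec z).2

theorem IsTypeR.coord_zpow (k : ℤ) : ι (↑(h.coord ^ k) : A) = zPow k := by
  ext z
  cases k with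
  | ofNat k => simp [zPow]
  | negSucc k =>
    rw [zpow_negSucc, ← inv_pow]
    simp [zPow]

theorem IsTypeR.coord_mem : (h.coord : A) ∈ plusAlg ι :=
  ⟨fun z => z, differentiable_id.diffContOnCl, fun z => h.coord_apply z⟩

theorem IsTypeR.coord_inv_mem : (↑h.coord⁻¹ : A) ∈ minusAlg ι :=
  ⟨fun z => z, differentiable_id.diffContOnCl, fun z => by
    change ι _ z⁻¹ = _
    simp⟩

theorem IsTypeR.evalZero_coord : evalZero ι ⟨h.coord, h.coord_mem⟩ = 0 :=
  evalZero_eq (F := fun z => z) differentiable_id.diffContOnCl fun z => h.coord_apply z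

theorem IsTypeR.evalExt_coord_inv (w : ball (0 : ℂ) 1) :
    evalExt ι w ⟨_, h.coord_inv_mem⟩ = w :=
  evalExt_eq (F := fun z => z) differentiable_id.diffContOnCl fun z => by simp

theorem IsTypeR.coord_inv_mul_mem {x : A} (hx : x ∈ plusAlg ι) (h0 : evalZero ι ⟨x, hx⟩ = 0) :
    ↑h.coord⁻¹ * x ∈ plusAlg ι :=
  div_mem_discAlgebra (f := ⟨ι x, hx⟩) h0 fun z => by simp

/-- The quotient is z (1 - wz)⁻¹ x. It belongs to `A` because the rational factor has its pole off
the circle, and it extends to the exterior because the zero of x at z⁻¹ = w cancels that pole. -/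
theorem IsTypeR.exists_div_minus {w : ball (0 : ℂ) 1} {x : A} (hx : x ∈ minusAlg ι)
    (h0 : evalExt ι w ⟨x, hx⟩ = 0) :
    ∃ y ∈ minusAlg ι, (↑h.coord⁻¹ - algebraMap ℂ A w) * y = x := by
  have hw : ‖(w : ℂ)‖ < 1 := mem_ball_zero_iff.1 w.2
  obtain ⟨a, ha⟩ := h.exists_inv_linear w hw.ne
  have hne (z : Circle) : 1 - (w : ℂ) * z ≠ 0 := one_sub_mul_ne_zero hw (Circle.norm_coe z).le
  have key (z : Circle) : ((z : ℂ)⁻¹ - w) * (ι h.coord z * ι a z * ι x z) = ι x z := by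
    rw [h.coord_apply, ha]
    rw [← mul_assoc, ← mul_assoc, sub_mul, inv_mul_cancel₀ z.coe_ne_zero,
      mul_inv_cancel₀ (hne z), one_mul]
  refine ⟨h.coord * a * x, div_mem_discAlgebra (w := w) (f := ⟨circleInv (ι x), hx⟩) h0 fun z => ?_,
    h.ext fun z => ?_⟩
  · have := key z⁻¹
    simpa using this
  · simpa [AlgHomClass.commutes] using key z

theorem IsTypeR.exists_plus_unit (w : ℂ) (hw : ‖w‖ < 1) :
    ∃ u : (plusAlg ι)ˣ, ((u : plusAlg ι) : A) = 1 - algebraMap ℂ A w * h.coord := by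
  obtain ⟨a, ha⟩ := h.exists_inv_linear w hw.ne
  have hd : DiffContOnCl ℂ (fun z => 1 - w * z) (ball 0 1) := by
    refine Differentiable.diffContOnCl ?_
    fun_prop
  have hmem : a ∈ plusAlg ι := by
    refine ⟨fun z => (1 - w * z)⁻¹, hd.inv fun z hz => ?_, fun z => ha z⟩
    rw [closure_ball (0 : ℂ) one_ne_zero] at hz
    exact one_sub_mul_ne_zero hw (by simpa using hz)
  have hmem' : 1 - algebraMap ℂ A w * h.coord ∈ plusAlg ι :=
    sub_mem (one_mem _) (mul_mem ((plusAlg ι).algebraMap_mem w) h.coord_mem)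
  refine ⟨.mkOfMulEqOne ⟨_, hmem'⟩ ⟨a, hmem⟩ (Subtype.ext (h.ext fun z => ?_)), rfl⟩
  have := one_sub_mul_ne_zero hw (Circle.norm_coe z).le
  simp [AlgHomClass.commutes, ha, this]

/-- In the variable y = z⁻¹ the inverse is (y - w)⁻¹, whose pole lies outside the closed disc. -/
theorem IsTypeR.exists_minus_unit (w : ℂ) (hw : 1 < ‖w‖) :
    ∃ u : (minusAlg ι)ˣ, ((u : minusAlg ι) : A) = ↑h.coord⁻¹ - algebraMap ℂ A w := by
  obtain ⟨a, ha⟩ := h.exists_inv_linear w hw.ne'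
  have hne (z : ℂ) (hz : ‖z‖ ≤ 1) : z - w ≠ 0 := fun h0 => by
    rw [sub_eq_zero.1 h0] at hz
    linarith
  have hmem : h.coord * a ∈ minusAlg ι := by
    refine ⟨fun z => (z - w)⁻¹, DiffContOnCl.inv ?_ fun z hz => ?_, fun z => ?_⟩
    · refine Differentiable.diffContOnCl ?_
      fun_prop
    · rw [closure_ball (0 : ℂ) one_ne_zero] at hz
      exact hne z (by simpa using hz)
    · change ι _ z⁻¹ = _
      have := hne z (Circle.norm_coe z).le
      rw [map_mul, ContinuousMap.mul_apply, h.coord_apply, ha, Circle.coe_inv]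
      field_simp
  have hmem' : ↑h.coord⁻¹ - algebraMap ℂ A w ∈ minusAlg ι :=
    sub_mem h.coord_inv_mem ((minusAlg ι).algebraMap_mem w)
  refine ⟨.mkOfMulEqOne ⟨_, hmem'⟩ ⟨_, hmem⟩ (Subtype.ext (h.ext fun z => ?_)), rfl⟩
  have h1 := hne (z : ℂ)⁻¹ (by simp [Circle.norm_coe])
  have h2 : (1 - w * z : ℂ) ≠ 0 := by
    have := mul_ne_zero h1 z.coe_ne_zero
    rwa [sub_mul, inv_mul_cancel₀ z.coe_ne_zero] at this
  simp only [MulMemClass.mk_mul_mk, map_mul, map_sub, ContinuousMap.mul_apply,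
    ContinuousMap.sub_apply, h.coord_inv_apply, AlgHomClass.commutes, h.coord_apply, ha,
    OneMemClass.coe_one, map_one, ContinuousMap.one_apply]
  change ((z : ℂ)⁻¹ - w) * (z * _) = 1
  rw [← mul_assoc, sub_mul, inv_mul_cancel₀ z.coe_ne_zero, mul_inv_cancel₀ h2]

theorem IsTypeR.not_isUnit_sub {w : ℂ} (hw : ‖w‖ = 1) :
    ¬ IsUnit (↑h.coord⁻¹ - algebraMap ℂ A w) := by
  intro hu
  obtain ⟨b, hb⟩ := hu.exists_right_inv
  obtain ⟨v, rfl⟩ : ∃ v : Circle, (v : ℂ) = w := ⟨⟨w, mem_sphere_zero_iff_norm.2 hw⟩, rfl⟩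
  have h1 := congrArg (fun y => ι y v⁻¹) hb
  simp only [map_mul, ContinuousMap.mul_apply, map_one, ContinuousMap.one_apply] at h1
  refine zero_ne_one (α := ℂ) (h1.symm.trans ?_).symm
  refine mul_eq_zero_of_left ?_ _
  rw [map_sub, ContinuousMap.sub_apply, h.coord_inv_apply, AlgHomClass.commutes]
  simp

theorem IsTypeR.eq_algebraMap {x : A} (hp : x ∈ plusAlg ι) (hm : x ∈ minusAlg ι) :
    x = algebraMap ℂ A (evalZero ι ⟨x, hp⟩) := by
  refine h.ext fun z => ?_
  rw [AlgHomClass.commutes]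
  exact eq_const_of_mem_disc_of_mem_ext ⟨ι x, hp⟩ hm z

/-- The product x z^k extends to both sides, hence is constant, and it vanishes at 0. -/
theorem IsTypeR.eq_zero_of_mul_pow_mem {x : A} (hp : x ∈ plusAlg ι) {k : ℕ} (hk : k ≠ 0)
    (hm : x * (h.coord : A) ^ k ∈ minusAlg ι) : x = 0 := by
  have hp' : x * (h.coord : A) ^ k ∈ plusAlg ι := mul_mem hp (pow_mem h.coord_mem k)
  have h1 := h.eq_algebraMap hp' hm
  have h2 : evalZero ι ⟨x * (h.coord : A) ^ k, hp'⟩ = 0 := by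
    have : (⟨x * (h.coord : A) ^ k, hp'⟩ : plusAlg ι) = ⟨x, hp⟩ * ⟨h.coord, h.coord_mem⟩ ^ k := rfl
    rw [this, map_mul, map_pow, h.evalZero_coord, zero_pow hk, mul_zero]
  rw [h2, map_zero] at h1
  rw [← Units.val_pow_eq_pow_val] at h1
  exact (Units.mul_left_eq_zero _).1 h1

end

/-! ### Permutation matrices, constant matrices and determinants. -/

section

variable {A : Type*} [CommRing A] [Algebra ℂ A] {n : ℕ}

/-- Permutation matrices as units. -/
def permUnit (R : Type*) [CommRing R] (σ : Equiv.Perm (Fin n)) : (Matrix (Fin n) (Fin n) R)ˣ where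
  val := (1 : Matrix (Fin n) (Fin n) R).submatrix σ id
  inv := (1 : Matrix (Fin n) (Fin n) R).submatrix σ.symm id
  val_inv := by
    ext i j
    simp [Matrix.mul_apply, Matrix.one_apply, ← Equiv.eq_symm_apply]
  inv_val := by
    ext i j
    simp [Matrix.mul_apply, Matrix.one_apply, ← Equiv.eq_symm_apply]

theorem diagonal_eq_permUnit (R : Type*) [CommRing R] (σ : Equiv.Perm (Fin n)) (d : Fin n → R) :
    Matrix.diagonal d = (permUnit R σ.symm).1 * Matrix.diagonal (d ∘ σ) * (permUnit R σ).1 := by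
  ext i j
  simp [permUnit, Matrix.mul_apply, Matrix.one_apply, Matrix.diagonal_apply,
    ← Equiv.eq_symm_apply]
  by_cases hij : i = j <;> simp [hij]

theorem mapMatrix_permUnit (S : Subalgebra ℂ A) (σ : Equiv.Perm (Fin n)) :
    S.val.mapMatrix (permUnit S σ).1 = (permUnit A σ).1 := by
  ext i j
  simp only [permUnit, AlgHom.mapMatrix_apply, Matrix.map_apply, Matrix.submatrix_apply,
    Matrix.one_apply]
  split_ifs <;> simp

/-- Used for matrices over a subalgebra that are built entry by entry when a factor is moved past a
diagonal one: comparing determinants in `A` replaces exhibiting an inverse. -/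
theorem isUnit_of_det_mapMatrix_eq (S : Subalgebra ℂ A) {x y : Matrix (Fin n) (Fin n) S}
    (hx : IsUnit x) (hxy : (S.val.mapMatrix x).det = (S.val.mapMatrix y).det) : IsUnit y := by
  rw [Matrix.isUnit_iff_isUnit_det] at hx ⊢
  have : x.det = y.det := Subtype.val_injective (by
    rw [← AlgHom.map_det, ← AlgHom.map_det] at hxy
    exact hxy)
  rwa [← this]

theorem det_updateRow_one (k : Fin n) (v : Fin n → ℂ) :
    ((1 : Matrix (Fin n) (Fin n) ℂ).updateRow k v).det = v k := by
  have : v = ∑ j, v j • (1 : Matrix (Fin n) (Fin n) ℂ) j := by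
    ext i
    simp [Matrix.one_apply]
  conv_lhs => rw [this]
  rw [Matrix.det_updateRow_sum]
  simp

/-- Constant matrices. -/
def constUnit (R : Type*) [CommRing R] [Algebra ℂ R] :
    (Matrix (Fin n) (Fin n) ℂ)ˣ →* (Matrix (Fin n) (Fin n) R)ˣ :=
  Units.map ((Algebra.ofId ℂ R).mapMatrix : _ →ₐ[ℂ] _).toMonoidHom

theorem mapMatrix_constUnit (S : Subalgebra ℂ A) (V : (Matrix (Fin n) (Fin n) ℂ)ˣ) :
    S.val.mapMatrix (constUnit S V).1 = (constUnit A V).1 := by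
  ext i j
  rfl

theorem constUnit_apply (R : Type*) [CommRing R] [Algebra ℂ R] (V : (Matrix (Fin n) (Fin n) ℂ)ˣ)
    (i j : Fin n) : (constUnit R V).1 i j = algebraMap ℂ R (V.1 i j) := rfl

end

/-! ### Factorizations and the operations that preserve them. -/

section

variable {A : Type*} [CommRing A] [Algebra ℂ A] [TopologicalSpace A] {ι : A →ₐ[ℂ] C(Circle, ℂ)}
  {n : ℕ}

/-- The factorization `x = g₊ D g₋`, with `g₊` and `g₋` invertible over the algebras of functions
that extend to the inside and to the outside of the circle, and with sorted exponents. -/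
def Factors (h : IsTypeR ι) (x : Matrix (Fin n) (Fin n) A) : Prop :=
  ∃ (κ : Fin n → ℤ) (gp : (Matrix (Fin n) (Fin n) (plusAlg ι))ˣ)
    (gm : (Matrix (Fin n) (Fin n) (minusAlg ι))ˣ), Antitone κ ∧
    x = (plusAlg ι).val.mapMatrix gp.1 * Matrix.diagonal (fun i => (↑(h.coord ^ κ i) : A)) *
      (minusAlg ι).val.mapMatrix gm.1

variable {h : IsTypeR ι} {x : Matrix (Fin n) (Fin n) A}

theorem Factors.mul_left (hx : Factors h x) (gp : (Matrix (Fin n) (Fin n) (plusAlg ι))ˣ) :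
    Factors h ((plusAlg ι).val.mapMatrix gp.1 * x) := by
  obtain ⟨κ, gp', gm, hκ, rfl⟩ := hx
  exact ⟨κ, gp * gp', gm, hκ, by simp only [Units.val_mul, map_mul, mul_assoc]⟩

theorem Factors.mul_right (hx : Factors h x) (gm : (Matrix (Fin n) (Fin n) (minusAlg ι))ˣ) :
    Factors h (x * (minusAlg ι).val.mapMatrix gm.1) := by
  obtain ⟨κ, gp, gm', hκ, rfl⟩ := hx
  exact ⟨κ, gp, gm' * gm, hκ, by simp only [Units.val_mul, map_mul, mul_assoc]⟩

theorem Factors.smul_zpow (hx : Factors h x) (m : ℤ) :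
    Factors h ((↑(h.coord ^ m) : A) • x) := by
  obtain ⟨κ, gp, gm, hκ, rfl⟩ := hx
  refine ⟨fun i => m + κ i, gp, gm, fun i j hij => by simpa using hκ hij, ?_⟩
  have : Matrix.diagonal (fun i => (↑(h.coord ^ (m + κ i)) : A)) =
      (↑(h.coord ^ m) : A) • Matrix.diagonal (fun i => (↑(h.coord ^ κ i) : A)) := by
    rw [← Matrix.diagonal_smul]
    congr 1
    ext i
    simp [zpow_add]
  rw [this, Matrix.mul_smul, Matrix.smul_mul]

theorem factors_diagonal (h : IsTypeR ι) (κ : Fin n → ℤ) :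
    Factors h (Matrix.diagonal (fun i => (↑(h.coord ^ κ i) : A))) := by
  obtain ⟨σ, hσ⟩ : ∃ σ : Equiv.Perm (Fin n), Antitone (κ ∘ σ) :=
    ⟨Tuple.sort (fun i => -κ i), fun i j hij => by
      simpa using Tuple.monotone_sort (fun i => -κ i) hij⟩
  refine ⟨κ ∘ σ, permUnit _ σ.symm, permUnit _ σ, hσ, ?_⟩
  rw [mapMatrix_permUnit, mapMatrix_permUnit]
  exact diagonal_eq_permUnit A σ _

theorem IsTypeR.zpow_neg_mem (h : IsTypeR ι) {m : ℤ} (hm : m ≤ 0) :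
    (↑(h.coord ^ m) : A) ∈ minusAlg ι := by
  obtain ⟨k, rfl⟩ := Int.exists_eq_neg_ofNat hm
  rw [zpow_neg, zpow_natCast, ← inv_pow, Units.val_pow_eq_pow_val]
  exact pow_mem h.coord_inv_mem k

/-- An upper triangular constant factor moves through `D` to the right. -/
theorem exists_const_mul_diagonal (h : IsTypeR ι) {κ : Fin n → ℤ} (hκ : Antitone κ)
    (V : (Matrix (Fin n) (Fin n) ℂ)ˣ) (hV : ∀ i j, j < i → V.1 i j = 0) :
    ∃ V' : (Matrix (Fin n) (Fin n) (minusAlg ι))ˣ,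
      (constUnit A V).1 * Matrix.diagonal (fun i => (↑(h.coord ^ κ i) : A)) =
        Matrix.diagonal (fun i => (↑(h.coord ^ κ i) : A)) * (minusAlg ι).val.mapMatrix V'.1 := by
  -- Conjugation by D multiplies entry (i, j) by z^(κ j - κ i); on and above the diagonal this
  -- exponent is at most 0.
  have hmem (i j) : algebraMap ℂ A (V.1 i j) * ↑(h.coord ^ (κ j - κ i)) ∈ minusAlg ι := by
    rcases lt_or_ge j i with hij | hij
    · rw [hV i j hij, map_zero, zero_mul]
      exact zero_mem _
    · exact mul_mem ((minusAlg ι).algebraMap_mem _) (h.zpow_neg_mem (by linarith [hκ hij]))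
  have key : (constUnit A V).1 * Matrix.diagonal (fun i => (↑(h.coord ^ κ i) : A)) =
      Matrix.diagonal (fun i => (↑(h.coord ^ κ i) : A)) *
        (minusAlg ι).val.mapMatrix (Matrix.of fun i j => ⟨_, hmem i j⟩) := by
    ext i j
    rw [Matrix.mul_diagonal, Matrix.diagonal_mul, constUnit_apply]
    simp only [AlgHom.mapMatrix_apply, Matrix.map_apply, Matrix.of_apply, Subalgebra.coe_val]
    rw [mul_left_comm, ← Units.val_mul, ← zpow_add]
    congr 3
    ring
  have hu : IsUnit (Matrix.of fun i j => (⟨_, hmem i j⟩ : minusAlg ι)) := by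
    refine isUnit_of_det_mapMatrix_eq _ (constUnit (minusAlg ι) V).isUnit ?_
    have := congrArg Matrix.det key
    rw [Matrix.det_mul, Matrix.det_mul, mul_comm, Matrix.det_diagonal, ← Units.coe_prod] at this
    rw [mapMatrix_constUnit]
    exact (Units.mul_right_inj _).1 this
  exact ⟨hu.unit, key⟩

/-- If the value at `0` of row `i` of `g` is the basis vector `k`, then
`diag(1, …, z⁻¹, …, 1)`, with `z⁻¹` in position `i`, moves through `g`, to position `k`. -/
theorem exists_shift_mul (h : IsTypeR ι) (g : (Matrix (Fin n) (Fin n) (plusAlg ι))ˣ) (i k : Fin n)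
    (hg : ∀ j, j ≠ k → evalZero ι (g.1 i j) = 0) :
    ∃ g' : (Matrix (Fin n) (Fin n) (plusAlg ι))ˣ,
      Matrix.diagonal (Function.update (1 : Fin n → A) i (↑h.coord⁻¹ : A)) * (plusAlg ι).val.mapMatrix g.1 =
        (plusAlg ι).val.mapMatrix g'.1 *
          Matrix.diagonal (Function.update (1 : Fin n → A) k (↑h.coord⁻¹ : A)) := by
  -- These are the entries of g'. Row i is divided by z, allowed off column k since the values at 0
  -- vanish; column k is multiplied by z, which cancels the division at (i, k).
  have hmem (a b) : Function.update (1 : Fin n → A) i (↑h.coord⁻¹ : A) a * g.1 a b *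
      Function.update (1 : Fin n → A) k (h.coord : A) b ∈ plusAlg ι := by
    have hz : ((g.1 a b : plusAlg ι) : A) * h.coord ∈ plusAlg ι := mul_mem (g.1 a b).2 h.coord_mem
    by_cases ha : a = i
    · subst ha
      by_cases hb : b = k
      · subst hb
        rw [Function.update_self, Function.update_self, mul_right_comm, Units.inv_mul, one_mul]
        exact (g.1 a b).2
      · rw [Function.update_self, Function.update_of_ne hb, Pi.one_apply, mul_one]
        exact h.coord_inv_mul_mem (g.1 a b).2 (hg b hb)
    · rw [Function.update_of_ne ha, Pi.one_apply, one_mul]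
      by_cases hb : b = k
      · subst hb
        rwa [Function.update_self]
      · rw [Function.update_of_ne hb, Pi.one_apply, mul_one]
        exact (g.1 a b).2
  have key : Matrix.diagonal (Function.update (1 : Fin n → A) i (↑h.coord⁻¹ : A)) *
      (plusAlg ι).val.mapMatrix g.1 = (plusAlg ι).val.mapMatrix (Matrix.of fun i j => ⟨_, hmem i j⟩) *
          Matrix.diagonal (Function.update (1 : Fin n → A) k (↑h.coord⁻¹ : A)) := by
    ext a b
    rw [Matrix.mul_diagonal, Matrix.diagonal_mul]
    simp only [AlgHom.mapMatrix_apply, Matrix.map_apply, Matrix.of_apply, Subalgebra.coe_val]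
    by_cases hb : b = k
    · subst hb
      rw [Function.update_self, Function.update_self, mul_assoc _ (h.coord : A),
        Units.mul_inv, mul_one]
    · rw [Function.update_of_ne hb, Function.update_of_ne hb]
      simp
  have hdet (i : Fin n) : (Matrix.diagonal (Function.update (1 : Fin n → A) i (↑h.coord⁻¹ : A))).det =
      ↑h.coord⁻¹ := by
    rw [Matrix.det_diagonal, Finset.prod_update_of_mem (Finset.mem_univ _)]
    simp
  have hu : IsUnit (Matrix.of fun i j => (⟨_, hmem i j⟩ : plusAlg ι)) := by
    refine isUnit_of_det_mapMatrix_eq _ g.isUnit ?_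
    have := congrArg Matrix.det key
    rw [Matrix.det_mul, Matrix.det_mul, mul_comm, hdet, hdet] at this
    exact (Units.mul_left_inj _).1 this
  exact ⟨hu.unit, key⟩

/-- Write g₊ = (g₊ V⁻¹) V with V constant and chosen so that row i of g₊ V⁻¹ is a basis vector at 0.
Then z⁻¹ passes through g₊ V⁻¹, V passes through D, and one exponent drops by 1. -/
theorem Factors.shift (hx : Factors h x) (i : Fin n) :
    Factors h (Matrix.diagonal (Function.update (1 : Fin n → A) i (↑h.coord⁻¹ : A)) * x) := by
  obtain ⟨κ, gp, gm, hκ, rfl⟩ := hx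
  set v : Fin n → ℂ := fun j => evalZero ι (gp.1 i j) with hv
  -- Minimality of k makes the identity with row k replaced by v upper triangular, as needed to pass
  -- through D; its determinant is v k.
  obtain ⟨k, hk, hmin⟩ : ∃ k, v k ≠ 0 ∧ ∀ j < k, v j = 0 := by
    have hne : {k | v k ≠ 0}.Nonempty := by
      by_contra hempty
      rw [Set.not_nonempty_iff_eq_empty, Set.eq_empty_iff_forall_notMem] at hempty
      have h1 := (((Matrix.isUnit_iff_isUnit_det _).1 gp.isUnit).map (evalZero ι)).ne_zero
      rw [AlgHom.map_det] at h1
      exact h1 (Matrix.det_eq_zero_of_row_eq_zero i fun j => by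
        have := hempty j
        simpa [hv] using this)
    obtain ⟨k, hk, hmin⟩ := WellFounded.has_min (wellFounded_lt (α := Fin n)) _ hne
    exact ⟨k, hk, fun j hj => by
      by_contra hj'
      exact hmin j hj' hj⟩
  have hVu : IsUnit ((1 : Matrix (Fin n) (Fin n) ℂ).updateRow k v) := by
    rw [Matrix.isUnit_iff_isUnit_det, det_updateRow_one]
    exact hk.isUnit
  obtain ⟨V, hV⟩ := hVu
  obtain ⟨V', hV'⟩ := exists_const_mul_diagonal h hκ V fun a b hab => by
    rw [hV]
    by_cases ha : a = k
    · subst ha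
      simpa using hmin b hab
    · rw [Matrix.updateRow_ne ha, Matrix.one_apply_ne hab.ne']
  have hrow : ∀ j, j ≠ k → evalZero ι ((gp * (constUnit (plusAlg ι) V)⁻¹).1 i j) = 0 := by
    intro j hj
    have h1 : (Pi.single k 1 : Fin n → ℂ) = Matrix.vecMul v (↑V⁻¹ : Matrix (Fin n) (Fin n) ℂ) := by
      have : Matrix.vecMul (Pi.single k 1) V.1 = v := by
        rw [hV, Matrix.single_one_vecMul]
        simp [Matrix.row]
      rw [← this, Matrix.vecMul_vecMul, Units.mul_inv, Matrix.vecMul_one]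
    have h2 : evalZero ι ((gp * (constUnit (plusAlg ι) V)⁻¹).1 i j) =
        Matrix.vecMul v (↑V⁻¹ : Matrix (Fin n) (Fin n) ℂ) j := by
      rw [← map_inv, Units.val_mul, Matrix.mul_apply, map_sum]
      simp only [map_mul, constUnit_apply, AlgHom.commutes]
      rfl
    rw [h2, ← h1, Pi.single_eq_of_ne hj]
  obtain ⟨g', hg'⟩ := exists_shift_mul h (gp * (constUnit (plusAlg ι) V)⁻¹) i k hrow
  have hgp : (plusAlg ι).val.mapMatrix gp.1 =
      (plusAlg ι).val.mapMatrix (gp * (constUnit (plusAlg ι) V)⁻¹).1 * (constUnit A V).1 := by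
    rw [← mapMatrix_constUnit (plusAlg ι), ← map_mul, ← Units.val_mul, inv_mul_cancel_right]
  have hD : Matrix.diagonal (Function.update (1 : Fin n → A) k (↑h.coord⁻¹ : A)) *
      Matrix.diagonal (fun i => (↑(h.coord ^ κ i) : A)) =
      Matrix.diagonal (fun i => (↑(h.coord ^ (Function.update κ k (κ k - 1) i)) : A)) := by
    rw [Matrix.diagonal_mul_diagonal]
    congr 1
    ext j
    by_cases hj : j = k
    · subst hj
      simp only [Function.update_self]
      rw [← Units.val_mul, zpow_sub_one, mul_comm]
    · simp [Function.update_of_ne hj]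
  -- Lowering one exponent may break the ordering; `factors_diagonal` sorts again with permutation
  -- matrices.
  have := (((factors_diagonal h (Function.update κ k (κ k - 1))).mul_left g').mul_right V').mul_right gm
  rw [← hD] at this
  convert this using 1
  rw [hgp]
  simp only [mul_assoc]
  rw [← mul_assoc (constUnit A V).1, hV', ← mul_assoc (Matrix.diagonal _) _ (_ * _), hg']
  simp only [mul_assoc]

end

/-! ### Induction on the degree of the determinant. -/

section

variable {A : Type*} [CommRing A] [Algebra ℂ A] [TopologicalSpace A] {ι : A →ₐ[ℂ] C(Circle, ℂ)}
  {n : ℕ}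

theorem IsTypeR.nontrivial (_h : IsTypeR ι) : Nontrivial A := by
  refine ⟨0, 1, fun h01 => ?_⟩
  have := congrArg (fun a => ι a 1) h01
  simp at this

theorem Factors.of_const_mul {h : IsTypeR ι} {x : Matrix (Fin n) (Fin n) A}
    (V : (Matrix (Fin n) (Fin n) ℂ)ˣ) (hx : Factors h ((constUnit A V).1 * x)) : Factors h x := by
  have := hx.mul_left (constUnit (plusAlg ι) V⁻¹)
  rwa [mapMatrix_constUnit, ← mul_assoc, ← Units.val_mul, ← map_mul, inv_mul_cancel, map_one,
    Units.val_one, one_mul] at this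

/-- A factor `z⁻¹ - w` with `|w| < 1` in one row can be split off. -/
theorem Factors.smul_row {h : IsTypeR ι} {x : Matrix (Fin n) (Fin n) A} (hx : Factors h x)
    (i : Fin n) {w : ℂ} (hw : ‖w‖ < 1) :
    Factors h (x.updateRow i ((↑h.coord⁻¹ - algebraMap ℂ A w) • x i)) := by
  -- The factor z⁻¹ - w equals (1 - wz) z⁻¹, a unit of `plusAlg` times a shift.
  obtain ⟨u, hu⟩ := h.exists_plus_unit w hw
  have hd : IsUnit (Matrix.diagonal (Function.update (1 : Fin n → plusAlg ι) i u)) := by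
    rw [Matrix.isUnit_iff_isUnit_det, Matrix.det_diagonal,
      Finset.prod_update_of_mem (Finset.mem_univ _)]
    simp
  have := (hx.shift i).mul_left hd.unit
  convert this using 1
  ext a b
  have hmap : (plusAlg ι).val.mapMatrix (Matrix.diagonal (Function.update (1 : Fin n → plusAlg ι) i u))
      = Matrix.diagonal (Function.update (1 : Fin n → A) i u) := by
    ext a b
    rw [AlgHom.mapMatrix_apply, Matrix.map_apply, Matrix.diagonal_apply, Matrix.diagonal_apply]
    by_cases ha : a = i
    · subst ha
      split_ifs <;> simp
    · split_ifs <;> simp [Function.update_of_ne ha]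
  rw [IsUnit.unit_spec, hmap, Matrix.diagonal_mul, Matrix.diagonal_mul]
  by_cases ha : a = i
  · subst ha
    simp only [Matrix.updateRow_self, Function.update_self, hu, Pi.smul_apply, smul_eq_mul]
    rw [← mul_assoc, sub_mul 1, one_mul, mul_assoc _ (h.coord : A), Units.mul_inv, mul_one]
  · simp [Matrix.updateRow_ne ha, Function.update_of_ne ha]

theorem factors_of_isUnit_minus (h : IsTypeR ι) {a : Matrix (Fin n) (Fin n) (minusAlg ι)}
    (ha : IsUnit a) : Factors h ((minusAlg ι).val.mapMatrix a) := by
  have := (factors_diagonal h (0 : Fin n → ℤ)).mul_right ha.unit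
  simpa using this

/-- A matrix over `A⁻` whose determinant is invertible in `A` and equal to a polynomial in `z⁻¹`,
up to a unit of `A⁻`, has a factorization. -/
theorem factors_of_det_eq (h : IsTypeR ι) (a : Matrix (Fin n) (Fin n) (minusAlg ι))
    (p : Polynomial ℂ) (e : (minusAlg ι)ˣ) (ha : IsUnit ((a.det : minusAlg ι) : A))
    (hdet : a.det = Polynomial.aeval ⟨_, h.coord_inv_mem⟩ p * e) :
    Factors h ((minusAlg ι).val.mapMatrix a) := by
  have := h.nontrivial
  induction hN : p.natDegree generalizing a p e with
  | zero =>
    obtain ⟨c, rfl⟩ := Polynomial.natDegree_eq_zero.1 hN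
    refine factors_of_isUnit_minus h ?_
    rw [Matrix.isUnit_iff_isUnit_det, hdet]
    refine IsUnit.mul ?_ e.isUnit
    rw [Polynomial.aeval_C]
    refine (IsUnit.mk0 c ?_).map (algebraMap ℂ (minusAlg ι))
    rintro rfl
    rw [hdet] at ha
    simp at ha
  | succ N ih =>
    have hdeg : 0 < p.degree := Polynomial.natDegree_pos_iff_degree_pos.1 (by omega)
    obtain ⟨w, hw⟩ := Complex.exists_root hdeg
    obtain ⟨q, rfl⟩ := Polynomial.dvd_iff_isRoot.2 hw
    have hq0 : q ≠ 0 := by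
      rintro rfl
      simp at hN
    have hqN : q.natDegree = N := by
      rw [Polynomial.natDegree_mul (Polynomial.X_sub_C_ne_zero w) hq0,
        Polynomial.natDegree_X_sub_C] at hN
      omega
    set s : minusAlg ι := ⟨_, h.coord_inv_mem⟩ with hs
    set t : minusAlg ι := s - algebraMap ℂ _ w with ht
    have htA : (t : A) = ↑h.coord⁻¹ - algebraMap ℂ A w := rfl
    rw [map_mul, map_sub, Polynomial.aeval_X, Polynomial.aeval_C, ← ht, mul_assoc] at hdet
    have htu : IsUnit (t : A) := by
      rw [hdet] at ha
      exact isUnit_of_mul_isUnit_left ha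
    rcases lt_trichotomy ‖w‖ 1 with hw1 | hw1 | hw1
    · set W : ball (0 : ℂ) 1 := ⟨w, mem_ball_zero_iff.2 hw1⟩ with hW
      have hev : evalExt ι W t = 0 := by
        rw [ht, map_sub, hs, h.evalExt_coord_inv, AlgHom.commutes]
        exact sub_self w
      have hsing : ((evalExt ι W).mapMatrix a).det = 0 := by
        rw [← AlgHom.map_det, hdet, map_mul, hev, zero_mul]
      -- A left null vector at z⁻¹ = w; an index i with v i ≠ 0 is the row to be replaced by the
      -- combination divided by t.
      obtain ⟨v, hv0, hv⟩ := Matrix.exists_vecMul_eq_zero_iff.2 hsing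
      obtain ⟨i, hi⟩ := Function.ne_iff.1 hv0
      have hrow (b : Fin n) : evalExt ι W (∑ j, v j • a j b) = 0 := by
        have := congrFun hv b
        simpa [Matrix.vecMul, dotProduct] using this
      have hdiv (b : Fin n) : ∃ y : minusAlg ι, t * y = ∑ j, v j • a j b := by
        obtain ⟨y, hy, hy'⟩ := h.exists_div_minus (∑ j, v j • a j b).2 (hrow b)
        exact ⟨⟨y, hy⟩, Subtype.ext hy'⟩
      choose y hy using hdiv
      have hty : t • y = ∑ j, v j • a j := by
        ext b
        simp [← hy]
      set a' := a.updateRow i y with ha'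
      have hdet' : t * a'.det = v i • a.det := by
        rw [ha', ← Matrix.det_updateRow_smul, hty]
        have := Matrix.det_updateRow_sum a i fun j => algebraMap ℂ (minusAlg ι) (v j)
        simp only [algebraMap_smul] at this
        exact this
      have hvi : IsUnit (algebraMap ℂ A (v i)) := (IsUnit.mk0 _ hi).map _
      have hdetA : (t : A) * (a'.det : minusAlg ι) = algebraMap ℂ A (v i) * (a.det : minusAlg ι) := by
        have := congrArg (Subtype.val : minusAlg ι → A) hdet'
        rwa [Algebra.smul_def] at this
      have hua' : IsUnit ((a'.det : minusAlg ι) : A) := by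
        refine isUnit_of_mul_isUnit_right (x := (t : A)) ?_
        rw [hdetA]
        exact hvi.mul ha
      -- Cancellation of t takes place in `A`, where t is a unit; in `minusAlg` it vanishes at w.
      have hcancel : a'.det = Polynomial.aeval s (Polynomial.C (v i) * q) * e := by
        refine Subtype.val_injective (htu.mul_left_cancel ?_)
        rw [hdetA, hdet, map_mul, Polynomial.aeval_C]
        change algebraMap ℂ A (v i) * ((t : A) * (_ * _)) = t * (algebraMap ℂ A (v i) * _ * _)
        ring
      have hfac := (ih a' _ e hua' hcancel (by rw [Polynomial.natDegree_C_mul hi, hqN])).smul_row i hw1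
      have hVu : IsUnit ((1 : Matrix (Fin n) (Fin n) ℂ).updateRow i v) := by
        rw [Matrix.isUnit_iff_isUnit_det, det_updateRow_one]
        exact IsUnit.mk0 _ hi
      -- The constant matrix with row i equal to v turns row i of a into t • y, that is, a' with row
      -- i multiplied by t.
      refine Factors.of_const_mul hVu.unit ?_
      convert hfac using 1
      have hc : (constUnit A hVu.unit).1 =
          (1 : Matrix (Fin n) (Fin n) A).updateRow i (fun j => algebraMap ℂ A (v j)) := by
        ext b c
        rw [constUnit_apply, IsUnit.unit_spec]
        by_cases hb : b = i
        · subst hb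
          simp
        · rw [Matrix.updateRow_ne hb, Matrix.updateRow_ne hb, Matrix.one_apply, Matrix.one_apply]
          split_ifs <;> simp
      rw [hc, Matrix.updateRow_mul, one_mul]
      ext b c
      by_cases hb : b = i
      · subst hb
        rw [Matrix.updateRow_self, Matrix.updateRow_self]
        change _ = (t : A) * ((a' b c : minusAlg ι) : A)
        rw [ha', Matrix.updateRow_self]
        have := congrArg (Subtype.val : minusAlg ι → A) (hy c)
        change (t : A) * y c = _ at this
        rw [this, ← Subalgebra.coe_val, map_sum]
        simp only [Matrix.vecMul, dotProduct, Algebra.smul_def]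
        rfl
      · rw [Matrix.updateRow_ne hb, Matrix.updateRow_ne hb]
        simp [ha', Matrix.updateRow_ne hb]
    · exact absurd htu (h.not_isUnit_sub hw1)
    -- A root with |w| > 1 is absorbed into the unit e, leaving the matrix unchanged.
    · obtain ⟨u, hu⟩ := h.exists_minus_unit w hw1
      have hut : (u : minusAlg ι) = t := Subtype.ext hu
      refine ih a q (u * e) ha ?_ hqN
      rw [hdet, Units.val_mul, hut]
      ring

/-! ### Uniqueness of the partial indices. -/

/-- A matrix with a large enough block of zeros is singular. -/
theorem det_eq_zero_of_block_zero {R : Type*} [CommRing R] (x : Matrix (Fin n) (Fin n) R)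
    (k : Fin n) (hx : ∀ i j, k ≤ i → j ≤ k → x i j = 0) : x.det = 0 := by
  rw [Matrix.det_apply]
  refine Finset.sum_eq_zero fun σ _ => ?_
  -- Pigeonhole: no permutation maps the indices ≤ k into the fewer indices < k, so every Leibniz
  -- term meets the zero block.
  obtain ⟨j, hj, hσ⟩ : ∃ j ≤ k, k ≤ σ j := by
    by_contra! hcon
    have := Finset.card_le_card_of_injOn (s := Finset.Iic k) (t := Finset.Iio k) σ
      (fun j hj => by simpa using hcon j (by simpa using hj)) σ.injective.injOn
    simp at this
  exact smul_eq_zero_of_right _ (Finset.prod_eq_zero (Finset.mem_univ j) (hx _ _ hσ hj))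

/-- If κ k > l k, monotonicity gives κ j > l i for all i ≥ k ≥ j. Then X i j times a positive power
of z lies in `minusAlg`, so X i j = 0 and det X = 0. -/
theorem exponents_le (h : IsTypeR ι) {κ l : Fin n → ℤ} (hκ : Antitone κ) (hl : Antitone l)
    (X : (Matrix (Fin n) (Fin n) (plusAlg ι))ˣ) (Y : Matrix (Fin n) (Fin n) (minusAlg ι))
    (hXY : (plusAlg ι).val.mapMatrix X.1 * Matrix.diagonal (fun i => (↑(h.coord ^ κ i) : A)) =
      Matrix.diagonal (fun i => (↑(h.coord ^ l i) : A)) * (minusAlg ι).val.mapMatrix Y) :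
    κ ≤ l := by
  intro k
  by_contra! hk
  have := h.nontrivial
  have hdet : X.1.det = 0 := by
    refine det_eq_zero_of_block_zero _ k fun i j hi hj => Subtype.ext ?_
    have hlt : l i < κ j := (hl hi).trans_lt (hk.trans_le (hκ hj))
    obtain ⟨m, hm⟩ := Int.eq_ofNat_of_zero_le (sub_nonneg.2 hlt.le)
    refine h.eq_zero_of_mul_pow_mem (X.1 i j).2 (k := m) (by omega) ?_
    have hij := congrFun (congrFun hXY i) j
    rw [Matrix.mul_diagonal, Matrix.diagonal_mul, AlgHom.mapMatrix_apply, AlgHom.mapMatrix_apply,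
      Matrix.map_apply, Matrix.map_apply, Subalgebra.coe_val, Subalgebra.coe_val] at hij
    have : ((X.1 i j : plusAlg ι) : A) * (h.coord : A) ^ m = Y i j := by
      rw [← Units.val_pow_eq_pow_val, ← zpow_natCast]
      have hm' : (m : ℤ) = κ j + -l i := by
        rw [← sub_eq_add_neg]
        exact hm.symm
      rw [hm', zpow_add, Units.val_mul, ← mul_assoc, hij, mul_right_comm, ← Units.val_mul,
        ← zpow_add, add_neg_cancel, zpow_zero, Units.val_one, one_mul]
    rw [this]
    exact (Y i j).2
  have hu := (Matrix.isUnit_iff_isUnit_det _).1 X.isUnit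
  rw [hdet] at hu
  exact not_isUnit_zero hu

theorem exponents_unique (h : IsTypeR ι) {κ l : Fin n → ℤ} (hκ : Antitone κ) (hl : Antitone l)
    (gp gp' : (Matrix (Fin n) (Fin n) (plusAlg ι))ˣ)
    (gm gm' : (Matrix (Fin n) (Fin n) (minusAlg ι))ˣ)
    (heq : (plusAlg ι).val.mapMatrix gp.1 * Matrix.diagonal (fun i => (↑(h.coord ^ κ i) : A)) *
        (minusAlg ι).val.mapMatrix gm.1 =
      (plusAlg ι).val.mapMatrix gp'.1 * Matrix.diagonal (fun i => (↑(h.coord ^ l i) : A)) *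
        (minusAlg ι).val.mapMatrix gm'.1) : κ = l := by
  have key : ∀ {κ l : Fin n → ℤ} (_ : Antitone κ) (_ : Antitone l)
    (gp gp' : (Matrix (Fin n) (Fin n) (plusAlg ι))ˣ)
    (gm gm' : (Matrix (Fin n) (Fin n) (minusAlg ι))ˣ)
    (_ : (plusAlg ι).val.mapMatrix gp.1 * Matrix.diagonal (fun i => (↑(h.coord ^ κ i) : A)) *
        (minusAlg ι).val.mapMatrix gm.1 =
      (plusAlg ι).val.mapMatrix gp'.1 * Matrix.diagonal (fun i => (↑(h.coord ^ l i) : A)) *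
        (minusAlg ι).val.mapMatrix gm'.1), κ ≤ l := by
    intro κ l hκ hl gp gp' gm gm' heq
    refine exponents_le h hκ hl (gp'⁻¹ * gp) (gm' * gm⁻¹).1 ?_
    have h1 := congrArg (fun x => (plusAlg ι).val.mapMatrix (↑gp'⁻¹ : Matrix _ _ _) * x *
      (minusAlg ι).val.mapMatrix (↑gm⁻¹ : Matrix _ _ _)) heq
    simp only [mul_assoc, ← map_mul, Units.mul_inv, map_one, mul_one] at h1
    simp only [← mul_assoc, ← map_mul, Units.inv_mul, map_one, one_mul] at h1
    simpa only [Units.val_mul, map_mul, mul_assoc] using h1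
  exact le_antisymm (key hκ hl gp gp' gm gm' heq) (key hl hκ gp' gp gm' gm heq.symm)

end

/-! ### Invertible matrices over subspaces, and openness of the unit group of matrices. -/

section

variable {A : Type*} [CommRing A] [Algebra ℂ A] {n : ℕ}

theorem exists_unit_of_mem_GLOver {S : Submodule ℂ A} {T : Subalgebra ℂ A}
    (hST : ∀ a, a ∈ S ↔ a ∈ T) {g : GL (Fin n) A} (hg : g ∈ GLOver n S) :
    ∃ u : (Matrix (Fin n) (Fin n) T)ˣ, T.val.mapMatrix u.1 = g.1 := by
  have hinj : Function.Injective (T.val.mapMatrix (m := Fin n)) := fun x y hxy =>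
    Matrix.ext fun i j => Subtype.ext (congrFun (congrFun hxy i) j)
  refine ⟨⟨Matrix.of fun i j => ⟨_, (hST _).1 (hg i j).1⟩,
    Matrix.of fun i j => ⟨_, (hST _).1 (hg i j).2⟩, hinj ?_, hinj ?_⟩, rfl⟩
  · rw [map_mul, map_one]
    exact Units.mul_inv g
  · rw [map_mul, map_one]
    exact Units.inv_mul g

theorem map_mem_GLOver {S : Submodule ℂ A} {T : Subalgebra ℂ A} (hST : ∀ a, a ∈ S ↔ a ∈ T)
    (u : (Matrix (Fin n) (Fin n) T)ˣ) :
    Units.map (T.val.mapMatrix (m := Fin n)).toMonoidHom u ∈ GLOver n S :=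
  fun i j => ⟨(hST _).2 (u.1 i j).2, (hST _).2 ((↑u⁻¹ : Matrix _ _ T) i j).2⟩

end

/-- Both properties pass from `A` to matrices through the determinant and the formula x⁻¹ = det(x)⁻¹
adj(x). -/
theorem isOpenUnits_matrix (A : Type*) [CommRing A] [TopologicalSpace A] [IsTopologicalRing A]
    [IsOpenUnits A] (n : ℕ) : IsOpenUnits (Matrix (Fin n) (Fin n) A) where
  isOpenEmbedding_unitsVal := by
    have hA := IsOpenUnits.isOpenEmbedding_unitsVal (M := A)
    have hset : {x : Matrix (Fin n) (Fin n) A | IsUnit x} =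
        Matrix.det ⁻¹' Set.range (Units.val : Aˣ → A) := by
      ext x
      exact Matrix.isUnit_iff_isUnit_det x
    have hinv : ContinuousOn (Ring.inverse : A → A) (Set.range (Units.val : Aˣ → A)) := by
      rintro _ ⟨u, rfl⟩
      refine ContinuousAt.continuousWithinAt ?_
      rw [ContinuousAt, ← hA.map_nhds_eq, tendsto_map'_iff]
      have hcomp : (Ring.inverse ∘ Units.val : Aˣ → A) = fun v => ((v⁻¹ : Aˣ) : A) := by
        ext v
        simp
      rw [hcomp, Ring.inverse_unit]
      exact (Units.continuous_val.comp continuous_inv).tendsto u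
    refine ⟨Units.isEmbedding_val_mk' (f := fun x => x⁻¹) ?_ fun u => (Matrix.coe_units_inv u).symm,
      ?_⟩
    · rw [hset]
      simp only [Matrix.inv_def]
      exact (hinv.comp continuous_id.matrix_det.continuousOn fun x hx => hx).smul
        continuous_id.matrix_adjugate.continuousOn
    · change IsOpen {x : Matrix (Fin n) (Fin n) A | IsUnit x}
      rw [hset]
      exact hA.isOpen_range.preimage continuous_id.matrix_det

/-! ### Approximation by Laurent polynomial matrices. -/

section

variable {A : Type*} [CommRing A] [Algebra ℂ A] [TopologicalSpace A] {ι : A →ₐ[ℂ] C(Circle, ℂ)}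

theorem IsTypeR.map_coord_pow (h : IsTypeR ι) (k : ℕ) : ι ((h.coord : A) ^ k) = zPow k := by
  rw [← h.coord_zpow, zpow_natCast, Units.val_pow_eq_pow_val]

theorem IsTypeR.map_coord_inv_pow (h : IsTypeR ι) (k : ℕ) :
    ι ((↑h.coord⁻¹ : A) ^ k) = zPow (-k) := by
  rw [← h.coord_zpow, zpow_neg, zpow_natCast, ← inv_pow, Units.val_pow_eq_pow_val]

theorem IsTypeR.comap_span_le (h : IsTypeR ι) {s : Set C(Circle, ℂ)} {S : Submodule ℂ A}
    (hs : ∀ f ∈ s, ∃ a ∈ S, ι a = f) : (Submodule.span ℂ s).comap ι.toLinearMap ≤ S := by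
  intro a ha
  have : Submodule.span ℂ s ≤ S.map ι.toLinearMap := by
    rw [Submodule.span_le]
    intro f hf
    obtain ⟨a, ha, rfl⟩ := hs f hf
    exact ⟨a, ha, rfl⟩
  obtain ⟨b, hb, hab⟩ := this ha
  rwa [← h.injective hab]

theorem IsDecomposing.exists_add [IsTopologicalRing A] (hd : IsDecomposing ι) (a : A) :
    ∃ p ∈ plus ι, ∃ o ∈ ominus ι, p + o = a :=
  Submodule.mem_sup.1 (hd.isCompl.sup_eq_top ▸ Submodule.mem_top)

/-- The Laurent polynomials in `A`. -/
def laurent (h : IsTypeR ι) : Subalgebra ℂ A := Algebra.adjoin ℂ {(h.coord : A), ↑h.coord⁻¹}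

theorem dense_laurent [IsTopologicalRing A] (h : IsTypeR ι) (hd : IsDecomposing ι) : Dense (laurent h : Set A) := by
  intro a
  have hp : (h.coord : A) ∈ laurent h := Algebra.subset_adjoin (by simp)
  have hm : (↑h.coord⁻¹ : A) ∈ laurent h := Algebra.subset_adjoin (by simp)
  have h1 : plus ι ≤ (laurent h).toSubmodule.topologicalClosure := by
    refine Submodule.topologicalClosure_mono (h.comap_span_le ?_)
    rintro _ ⟨k, rfl⟩
    exact ⟨(h.coord : A) ^ k, pow_mem hp k, h.map_coord_pow k⟩
  have h2 : ominus ι ≤ (laurent h).toSubmodule.topologicalClosure := by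
    refine Submodule.topologicalClosure_mono (h.comap_span_le ?_)
    rintro _ ⟨k, rfl⟩
    exact ⟨(↑h.coord⁻¹ : A) ^ (k + 1), pow_mem hm _, by exact_mod_cast h.map_coord_inv_pow (k + 1)⟩
  obtain ⟨p, hp, o, ho, rfl⟩ := hd.exists_add a
  exact add_mem (h1 hp) (h2 ho)

theorem exists_laurent_near {n : ℕ} [IsTopologicalRing A] [IsOpenUnits A] (h : IsTypeR ι) (hd : IsDecomposing ι)
    (g : GL (Fin n) A) {W : Set (GL (Fin n) A)} (hW : W ∈ 𝓝 1) :
    ∃ r : GL (Fin n) A, (∀ i j, r.1 i j ∈ laurent h) ∧ g * r⁻¹ ∈ W := by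
  have := isOpenUnits_matrix A n
  have hnhd : {r : GL (Fin n) A | g * r⁻¹ ∈ W} ∈ 𝓝 g := by
    have hc : ContinuousAt (fun r : GL (Fin n) A => g * r⁻¹) g :=
      (continuous_const.mul continuous_inv).continuousAt
    refine hc (?_ : W ∈ 𝓝 (g * g⁻¹))
    rwa [mul_inv_cancel]
  have hopen := (IsOpenUnits.isOpenEmbedding_unitsVal
    (M := Matrix (Fin n) (Fin n) A)).image_mem_nhds.2 hnhd
  have hdense : Dense {x : Matrix (Fin n) (Fin n) A | ∀ i j, x i j ∈ laurent h} := by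
    have := dense_pi (Set.univ : Set (Fin n)) (s := fun _ => Set.pi Set.univ fun _ : Fin n =>
      (laurent h : Set A)) fun _ _ => dense_pi _ fun _ _ => dense_laurent h hd
    refine this.mono fun x hx i j => ?_
    exact hx i (Set.mem_univ i) j (Set.mem_univ j)
  obtain ⟨_, hx, r, hr, rfl⟩ := hdense.inter_nhds_nonempty hopen
  exact ⟨r, hx, hr⟩

/-- The representation is demanded for every large k so that all entries of a matrix can share one
exponent. -/
theorem exists_eq_pow_mul_aeval (h : IsTypeR ι) {a : A} (ha : a ∈ laurent h) :
    ∃ m : ℕ, ∀ k ≥ m, ∃ p : Polynomial ℂ,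
      a = (h.coord : A) ^ k * Polynomial.aeval (↑h.coord⁻¹ : A) p := by
  induction ha using Algebra.adjoin_induction with
  | mem x hx =>
    have hinv (k : ℕ) : (h.coord : A) ^ k * (↑h.coord⁻¹ : A) ^ k = 1 := by
      rw [← mul_pow, Units.mul_inv, one_pow]
    rcases hx with rfl | rfl
    · refine ⟨1, fun k hk => ?_⟩
      obtain ⟨k, rfl⟩ := Nat.exists_eq_add_of_le hk
      refine ⟨Polynomial.X ^ k, ?_⟩
      rw [map_pow, Polynomial.aeval_X, pow_add, mul_assoc, hinv, pow_one, mul_one]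
    · refine ⟨0, fun k _ => ⟨Polynomial.X ^ (k + 1), ?_⟩⟩
      rw [map_pow, Polynomial.aeval_X, pow_succ, ← mul_assoc, hinv, one_mul]
  | algebraMap c =>
    refine ⟨0, fun k _ => ⟨Polynomial.C c * Polynomial.X ^ k, ?_⟩⟩
    rw [map_mul, Polynomial.aeval_C, map_pow, Polynomial.aeval_X, mul_left_comm, ← mul_pow,
      Units.mul_inv, one_pow, mul_one]
  | add x y _ _ hx hy =>
    obtain ⟨m, hm⟩ := hx
    obtain ⟨m', hm'⟩ := hy
    refine ⟨max m m', fun k hk => ?_⟩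
    obtain ⟨p, rfl⟩ := hm k (le_trans (le_max_left _ _) hk)
    obtain ⟨q, rfl⟩ := hm' k (le_trans (le_max_right _ _) hk)
    exact ⟨p + q, by rw [map_add, mul_add]⟩
  | mul x y _ _ hx hy =>
    obtain ⟨m, hm⟩ := hx
    obtain ⟨m', hm'⟩ := hy
    refine ⟨m + m', fun k hk => ?_⟩
    obtain ⟨p, rfl⟩ := hm (k - m') (by omega)
    obtain ⟨q, rfl⟩ := hm' m' le_rfl
    refine ⟨p * q, ?_⟩
    have : k = (k - m') + m' := by omega
    conv_rhs => rw [this, pow_add, map_mul]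
    ring

end

/-! ### Identification of A⁺ and A⁻, and the factorization in general. -/

section

variable {A : Type*} [CommRing A] [Algebra ℂ A] [TopologicalSpace A] {ι : A →ₐ[ℂ] C(Circle, ℂ)}
  {n : ℕ} [IsTopologicalRing A] [ContinuousSMul ℂ A]

/-- Homomorphisms from an algebra with open unit group to `C(Circle, ℂ)` are continuous. -/
theorem continuous_of_isOpenUnits [IsOpenUnits A] (ι : A →ₐ[ℂ] C(Circle, ℂ)) : Continuous ι := by
  have hunits : {a : A | IsUnit (1 + a)} ∈ 𝓝 (0 : A) := by
    have ho : IsOpen {a : A | IsUnit a} := by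
      have := (IsOpenUnits.isOpenEmbedding_unitsVal (M := A)).isOpen_range
      exact this
    have hc : Continuous fun a : A => 1 + a := continuous_const.add continuous_id
    exact (ho.preimage hc).mem_nhds (by simp)
  obtain ⟨V, ⟨hV, hbal⟩, hVU⟩ := (nhds_basis_balanced ℂ A).mem_iff.1 hunits
  have hbound (a : A) (ha : a ∈ V) : ‖ι a‖ ≤ 1 := by
    rw [ContinuousMap.norm_le _ zero_le_one]
    intro z
    by_contra! hz
    have hne : ι a z ≠ 0 := fun h0 => by
      rw [h0, norm_zero] at hz
      linarith
    -- If |a(z)| > 1, balancedness keeps -a/a(z) in V, although 1 - a/a(z) vanishes at z and cannot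
    -- be a unit.
    have hmem : (-(ι a z)⁻¹) • a ∈ V := hbal.smul_mem (by
      rw [norm_neg, norm_inv]
      exact inv_le_one_of_one_le₀ hz.le) ha
    obtain ⟨b, hb⟩ := (show IsUnit _ from hVU hmem).exists_right_inv
    have := congrArg (fun y => ι y z) hb
    simp only [map_mul, map_add, map_smul, map_one, ContinuousMap.mul_apply,
      ContinuousMap.add_apply, ContinuousMap.smul_apply, ContinuousMap.one_apply, smul_eq_mul,
      neg_mul, inv_mul_cancel₀ hne, add_neg_cancel, zero_mul] at this
    exact zero_ne_one this
  refine continuous_of_continuousAt_zero ι ?_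
  rw [ContinuousAt, map_zero, Metric.nhds_basis_closedBall.tendsto_right_iff]
  intro ε hε
  have hε' : (ε : ℂ) ≠ 0 := by exact_mod_cast hε.ne'
  filter_upwards [(set_smul_mem_nhds_zero_iff hε').2 hV] with a ha
  obtain ⟨b, hb, rfl⟩ := ha
  rw [mem_closedBall_zero_iff]
  change ‖ι ((ε : ℂ) • b)‖ ≤ ε
  rw [map_smul, norm_smul, Complex.norm_real, Real.norm_of_nonneg hε.le]
  exact mul_le_of_le_one_right hε.le (hbound b hb)

theorem plus_le [IsOpenUnits A] (h : IsTypeR ι) : plus ι ≤ (plusAlg ι).toSubmodule := by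
  refine Submodule.topologicalClosure_minimal _ (h.comap_span_le ?_)
    (isClosed_discAlgebra.preimage (continuous_of_isOpenUnits ι))
  rintro _ ⟨k, rfl⟩
  exact ⟨(h.coord : A) ^ k, pow_mem h.coord_mem k, h.map_coord_pow k⟩

/-- This records the vanishing of A^⊖ at infinity, which excludes nonzero constants from A^⊖. -/
theorem coord_mul_mem_of_mem_ominus [IsOpenUnits A] (h : IsTypeR ι) {a : A} (ha : a ∈ ominus ι) :
    h.coord * a ∈ minusAlg ι := by
  have : ominus ι ≤ (minusAlg ι).toSubmodule.comap (LinearMap.mulLeft ℂ (h.coord : A)) := by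
    refine Submodule.topologicalClosure_minimal _ (h.comap_span_le ?_)
      ((isClosed_extAlgebra.preimage (continuous_of_isOpenUnits ι)).preimage
        (continuous_const_mul (h.coord : A)))
    rintro _ ⟨k, rfl⟩
    refine ⟨(↑h.coord⁻¹ : A) ^ (k + 1), ?_, by exact_mod_cast h.map_coord_inv_pow (k + 1)⟩
    change (h.coord : A) * (↑h.coord⁻¹ : A) ^ (k + 1) ∈ minusAlg ι
    rw [pow_succ', ← mul_assoc, Units.mul_inv, one_mul]
    exact pow_mem h.coord_inv_mem k
  exact this ha

theorem ominus_le [IsOpenUnits A] (h : IsTypeR ι) : ominus ι ≤ (minusAlg ι).toSubmodule := by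
  intro a ha
  have := mul_mem h.coord_inv_mem (coord_mul_mem_of_mem_ominus h ha)
  rwa [← mul_assoc, Units.inv_mul, one_mul] at this

/-- In a decomposing algebra, `A⁺` consists of all elements that extend to the disc. -/
theorem mem_plus_iff [IsOpenUnits A] (h : IsTypeR ι) (hd : IsDecomposing ι) (a : A) :
    a ∈ plus ι ↔ a ∈ plusAlg ι := by
  refine ⟨fun ha => plus_le h ha, fun ha => ?_⟩
  obtain ⟨p, hp, o, ho, rfl⟩ := hd.exists_add a
  have h1 : o ∈ plusAlg ι := by
    have := sub_mem ha (plus_le h hp)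
    rwa [add_sub_cancel_left] at this
  have h2 : o = 0 := h.eq_zero_of_mul_pow_mem h1 one_ne_zero (by
    rw [pow_one, mul_comm]
    exact coord_mul_mem_of_mem_ominus h ho)
  rwa [h2, add_zero]

/-- In a decomposing algebra, `A⁻` consists of all elements that extend to the exterior. -/
theorem mem_minus_iff [IsOpenUnits A] (h : IsTypeR ι) (hd : IsDecomposing ι) (a : A) :
    a ∈ minus ι ↔ a ∈ minusAlg ι := by
  constructor
  · intro ha
    refine (sup_le (ominus_le h) ?_ : minus ι ≤ (minusAlg ι).toSubmodule) ha
    rw [Submodule.span_le, Set.singleton_subset_iff]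
    exact one_mem (minusAlg ι)
  · intro ha
    obtain ⟨p, hp, o, ho, rfl⟩ := hd.exists_add a
    have h1 : p ∈ minusAlg ι := by
      have := sub_mem ha (ominus_le h ho)
      rwa [add_sub_cancel_right] at this
    rw [h.eq_algebraMap (plus_le h hp) h1, add_comm]
    refine Submodule.add_mem_sup ho (?_)
    rw [Algebra.algebraMap_eq_smul_one]
    exact Submodule.smul_mem _ _ (Submodule.mem_span_singleton_self 1)

theorem factorsWith_iff [IsOpenUnits A] (h : IsTypeR ι) (hd : IsDecomposing ι) (g : GL (Fin n) A)
    (κ : Fin n → ℤ) : FactorsWith ι g κ ↔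
      ∃ (gp : (Matrix (Fin n) (Fin n) (plusAlg ι))ˣ) (gm : (Matrix (Fin n) (Fin n) (minusAlg ι))ˣ),
        g.1 = (plusAlg ι).val.mapMatrix gp.1 *
          Matrix.diagonal (fun i => (↑(h.coord ^ κ i) : A)) * (minusAlg ι).val.mapMatrix gm.1 := by
  have hD : (Matrix.diagonal (fun i => (↑(h.coord ^ κ i) : A))).map ι =
      Matrix.diagonal (fun i => zPow (κ i)) := by
    rw [Matrix.diagonal_map (map_zero ι)]
    congr 1
    ext1 i
    exact h.coord_zpow _
  constructor
  · rintro ⟨gp, hgp, gm, hgm, D, hDz, hg⟩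
    obtain ⟨u, hu⟩ := exists_unit_of_mem_GLOver (mem_plus_iff h hd) hgp
    obtain ⟨v, hv⟩ := exists_unit_of_mem_GLOver (mem_minus_iff h hd) hgm
    refine ⟨u, v, ?_⟩
    rw [hu, hv, hg, Matrix.map_injective h.injective (hDz.trans hD.symm)]
  · rintro ⟨u, v, hg⟩
    exact ⟨_, map_mem_GLOver (mem_plus_iff h hd) u, _, map_mem_GLOver (mem_minus_iff h hd) v, _, hD,
      hg⟩

theorem factors_of_productIsIdentityNhd [IsOpenUnits A] (h : IsTypeR ι) (hd : IsDecomposing ι)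
    (hW : ProductIsIdentityNhd n ι) (g : GL (Fin n) A) : Factors h g.1 := by
  obtain ⟨r, hr, gp, hgp, gm, hgm, hgr⟩ := exists_laurent_near h hd g hW
  obtain ⟨u, hu⟩ := exists_unit_of_mem_GLOver (mem_plus_iff h hd) hgp
  obtain ⟨v, hv⟩ := exists_unit_of_mem_GLOver (mem_minus_iff h hd) hgm
  choose m hm using fun i j => exists_eq_pow_mul_aeval h (hr i j)
  set N := Finset.univ.sup fun i => Finset.univ.sup fun j => m i j with hN
  have hmN (i j) : m i j ≤ N := (Finset.le_sup (f := fun j => m i j) (Finset.mem_univ j)).trans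
    (Finset.le_sup (f := fun i => Finset.univ.sup fun j => m i j) (Finset.mem_univ i))
  choose p hp using fun i j => hm i j N (hmN i j)
  set s : minusAlg ι := ⟨_, h.coord_inv_mem⟩ with hs
  set q : Matrix (Fin n) (Fin n) (minusAlg ι) := (Polynomial.aeval s).mapMatrix (Matrix.of p) with hq
  have hrq : r.1 = (↑(h.coord ^ (N : ℤ)) : A) • (minusAlg ι).val.mapMatrix q := by
    ext i j
    rw [Matrix.smul_apply, smul_eq_mul, zpow_natCast, Units.val_pow_eq_pow_val]
    refine (hp i j).trans ?_
    congr 1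
    exact Polynomial.aeval_algHom_apply (minusAlg ι).val s (p i j)
  have hg : g.1 = (plusAlg ι).val.mapMatrix u.1 * ((↑(h.coord ^ (N : ℤ)) : A) •
      (minusAlg ι).val.mapMatrix (v.1 * q)) := by
    have : g = gp * gm * r := by rw [← hgr, inv_mul_cancel_right]
    rw [this, Units.val_mul, Units.val_mul, ← hu, ← hv, hrq, map_mul, mul_assoc, Matrix.mul_smul]
  rw [hg]
  -- The scalar z^N only translates the exponents; what remains is g₋ q, with determinant (det
  -- g₋)(det q).
  refine Factors.mul_left (Factors.smul_zpow ?_ N) u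
  refine factors_of_det_eq h (v.1 * q) (Matrix.of p).det
    ((Matrix.isUnit_iff_isUnit_det _).1 v.isUnit).unit ?_ ?_
  · have h1 := (Matrix.isUnit_iff_isUnit_det _).1 r.isUnit
    have h2 := (Matrix.isUnit_iff_isUnit_det _).1 gm.isUnit
    rw [hrq, Matrix.det_smul] at h1
    have h3 := isUnit_of_mul_isUnit_right h1
    rw [← hv] at h2
    have h4 := h2.mul h3
    rw [← Matrix.det_mul, ← map_mul, ← AlgHom.map_det] at h4
    exact h4
  · rw [Matrix.det_mul, hq, ← AlgHom.map_det, IsUnit.unit_spec, mul_comm]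

theorem hasBirkhoffFactorization [IsOpenUnits A] (h : IsTypeR ι) (hd : IsDecomposing ι)
    (hW : ProductIsIdentityNhd n ι) : HasBirkhoffFactorization n ι := by
  intro g
  obtain ⟨κ, gp, gm, hκ, hg⟩ := factors_of_productIsIdentityNhd h hd hW g
  refine ⟨κ, ⟨hκ, (factorsWith_iff h hd g κ).2 ⟨gp, gm, hg⟩⟩, ?_⟩
  rintro l ⟨hl, hgl⟩
  obtain ⟨gp', gm', hg'⟩ := (factorsWith_iff h hd g l).1 hgl
  exact exponents_unique h hl hκ gp' gp gm' gm (hg'.symm.trans hg)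

end

/-! ### The identity neighbourhood in the Banach case. -/

section

variable {A : Type*} [NormedCommRing A] [NormedAlgebra ℂ A] [CompleteSpace A]

theorem isCIA_of_completeSpace (A : Type*) [NormedCommRing A] [NormedAlgebra ℂ A]
    [CompleteSpace A] : IsCIA A where
  isOpenEmbedding_unitsVal := Units.isOpenEmbedding_val

/-- The inverse of an element near `1` of a closed subalgebra lies in the subalgebra. -/
theorem exists_inv_mem {S : Subalgebra ℂ A} (hS : IsClosed (S : Set A)) {a : A} (ha : a ∈ S)
    (h1 : ‖1 - a‖ < 1) : ∃ b ∈ S, a * b = 1 := by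
  refine ⟨∑' k : ℕ, (1 - a) ^ k, ?_, ?_⟩
  · have hs := (summable_geometric_of_norm_lt_one h1).hasSum.tendsto_sum_nat
    exact hS.mem_of_tendsto hs (Eventually.of_forall fun k =>
      sum_mem fun i _ => pow_mem (sub_mem (one_mem S) ha) i)
  · have := mul_neg_geom_series (1 - a) h1
    rwa [sub_sub_cancel] at this

variable {n : ℕ}

/-- Near 1 the determinant is close to 1, and its Neumann series stays in the closed subalgebra. -/
theorem eventually_exists_unit {S : Subalgebra ℂ A} (hS : IsClosed (S : Set A)) :
    ∀ᶠ x in 𝓝 (1 : Matrix (Fin n) (Fin n) A), (∀ i j, x i j ∈ S) →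
      ∃ u : (Matrix (Fin n) (Fin n) S)ˣ, S.val.mapMatrix u.1 = x := by
  have hc : Tendsto (fun x : Matrix (Fin n) (Fin n) A => ‖1 - x.det‖) (𝓝 1) (𝓝 0) := by
    have : Continuous fun x : Matrix (Fin n) (Fin n) A => ‖1 - x.det‖ :=
      (continuous_const.sub continuous_id.matrix_det).norm
    simpa using this.tendsto 1
  filter_upwards [hc.eventually_lt_const zero_lt_one] with x hx hxS
  set y : Matrix (Fin n) (Fin n) S := Matrix.of fun i j => ⟨x i j, hxS i j⟩ with hy
  have hyx : S.val.mapMatrix y = x := rfl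
  have hdet : ((y.det : S) : A) = x.det := by
    rw [← hyx, ← AlgHom.map_det]
    rfl
  obtain ⟨b, hb, hb1⟩ := exists_inv_mem hS y.det.2 (by rwa [hdet])
  have hu : IsUnit y := by
    rw [Matrix.isUnit_iff_isUnit_det]
    exact IsUnit.of_mul_eq_one ⟨b, hb⟩ (Subtype.ext hb1)
  exact ⟨hu.unit, hyx⟩

/-- If `1 = p + q` for continuous linear maps, matrices near `1` have the form
`(1 + p x) (1 + q x)` with small `x`. -/
theorem map_nhds_one_add_mul (p q : A →L[ℂ] A) (hpq : ∀ a, p a + q a = a) :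
    map (fun x : Fin n → Fin n → A => (1 + (Matrix.of x).map p) * (1 + (Matrix.of x).map q))
      (𝓝 0) = 𝓝 (1 : Matrix (Fin n) (Fin n) A) := by
  -- The linear part at 0 is p x + q x = x, so the derivative is the identity and the inverse
  -- function theorem applies.
  have hd : HasStrictFDerivAt (𝕜 := ℂ)
      (fun (x : Fin n → Fin n → A) (i j : Fin n) =>
        ∑ k, ((1 : Matrix (Fin n) (Fin n) A) i k + p (x i k)) *
          ((1 : Matrix (Fin n) (Fin n) A) k j + q (x k j)))
      ((ContinuousLinearEquiv.refl ℂ (Fin n → Fin n → A) : _ ≃L[ℂ] _) : _ →L[ℂ] _) 0 := by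
    rw [hasStrictFDerivAt_pi']
    intro i
    rw [hasStrictFDerivAt_pi']
    intro j
    have happ (r : A →L[ℂ] A) (c : A) (i j : Fin n) :
        HasStrictFDerivAt (fun x : Fin n → Fin n → A => c + r (x i j))
        (r ∘L (ContinuousLinearMap.proj (R := ℂ) (φ := fun _ : Fin n => A) j ∘L
          ContinuousLinearMap.proj (R := ℂ) (φ := fun _ : Fin n => Fin n → A) i)) 0 :=
      (r ∘L (ContinuousLinearMap.proj (R := ℂ) (φ := fun _ : Fin n => A) j ∘L
        ContinuousLinearMap.proj (R := ℂ) (φ := fun _ : Fin n => Fin n → A) i)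
        ).hasStrictFDerivAt.const_add c
    have hsum := HasStrictFDerivAt.fun_sum (u := Finset.univ) fun k _ =>
      (happ p ((1 : Matrix (Fin n) (Fin n) A) i k) i k).mul
        (happ q ((1 : Matrix (Fin n) (Fin n) A) k j) k j)
    refine hsum.congr_fderiv ?_
    ext x
    have h1 (i j : Fin n) (y : A) :
        (1 : Matrix (Fin n) (Fin n) A) i j * y = if i = j then y else 0 := by
      rw [Matrix.one_apply, ite_mul, one_mul, zero_mul]
    have h2 (i j : Fin n) (y : A) :
        (1 : Matrix (Fin n) (Fin n) A) i j * y = if j = i then y else 0 := by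
      rw [h1]
      simp only [eq_comm]
    rw [sum_apply]
    simp only [add_apply, _root_.smul_apply, smul_eq_mul,
      ContinuousLinearMap.comp_apply, ContinuousLinearMap.proj_apply, Pi.zero_apply, map_zero,
      add_zero, Finset.sum_add_distrib]
    rw [Finset.sum_congr rfl fun k _ => h1 i k (q (x k j)),
      Finset.sum_congr rfl fun k _ => h2 k j (p (x i k))]
    simp [add_comm, hpq]
  have := hd.map_nhds_eq_of_equiv
  have h0 : (fun i j : Fin n => ∑ k, ((1 : Matrix (Fin n) (Fin n) A) i k + p ((0 : Fin n → Fin n → A) i k)) *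
          ((1 : Matrix (Fin n) (Fin n) A) k j + q ((0 : Fin n → Fin n → A) k j))) =
      (1 : Matrix (Fin n) (Fin n) A) := by
    ext i j
    simp [Matrix.one_apply]
  rw [h0] at this
  exact this

theorem productIsIdentityNhd_of_completeSpace {ι : A →ₐ[ℂ] C(Circle, ℂ)} (h : IsTypeR ι)
    (hd : IsDecomposing ι) : ProductIsIdentityNhd n ι := by
  have := isCIA_of_completeSpace A
  have hplus : IsClosed (plusAlg ι : Set A) :=
    isClosed_discAlgebra.preimage (continuous_of_isOpenUnits ι)
  have hminus : IsClosed (minusAlg ι : Set A) :=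
    isClosed_extAlgebra.preimage (continuous_of_isOpenUnits ι)
  set p : A →L[ℂ] A := (plus ι).projectionL (ominus ι) hd with hp
  set q : A →L[ℂ] A := (ominus ι).projectionL (plus ι) hd.symm with hq
  have hpq (a : A) : p a + q a = a := by
    simp only [hp, hq, Submodule.coe_projectionL]
    exact Submodule.projection_add_projection_eq_self hd.isCompl a
  have hpm (a : A) : p a ∈ plusAlg ι := plus_le h (Submodule.projection_apply_mem _ a)
  have hqm (a : A) : q a ∈ minusAlg ι := ominus_le h (Submodule.projection_apply_mem _ a)
  have hlim (r : A →L[ℂ] A) : Tendsto (fun x : Fin n → Fin n → A =>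
      (1 : Matrix (Fin n) (Fin n) A) + (Matrix.of x).map r) (𝓝 0) (𝓝 1) := by
    have hc : Continuous fun x : Fin n → Fin n → A =>
        (1 : Matrix (Fin n) (Fin n) A) + (Matrix.of x).map r :=
      continuous_const.add (continuous_matrix fun i j =>
        r.continuous.comp ((continuous_apply j).comp (continuous_apply i)))
    convert hc.tendsto 0 using 2
    ext i j
    simp
  have hone (S : Subalgebra ℂ A) (i j : Fin n) : (1 : Matrix (Fin n) (Fin n) A) i j ∈ S := by
    rw [Matrix.one_apply]
    split_ifs
    exacts [one_mem S, zero_mem S]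
  have hev : ∀ᶠ x in 𝓝 (1 : Matrix (Fin n) (Fin n) A),
      ∃ (u : (Matrix (Fin n) (Fin n) (plusAlg ι))ˣ) (v : (Matrix (Fin n) (Fin n) (minusAlg ι))ˣ),
        x = (plusAlg ι).val.mapMatrix u.1 * (minusAlg ι).val.mapMatrix v.1 := by
    rw [← map_nhds_one_add_mul p q hpq, eventually_map]
    filter_upwards [(hlim p).eventually (eventually_exists_unit hplus),
      (hlim q).eventually (eventually_exists_unit hminus)] with x hx hx'
    obtain ⟨u, hu⟩ := hx fun i j => add_mem (hone _ i j) (hpm _)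
    obtain ⟨v, hv⟩ := hx' fun i j => add_mem (hone _ i j) (hqm _)
    exact ⟨u, v, by rw [hu, hv]⟩
  filter_upwards [(Units.continuous_val (M := Matrix (Fin n) (Fin n) A)).tendsto 1 |>.eventually hev]
    with g hg
  obtain ⟨u, v, huv⟩ := hg
  exact ⟨_, map_mem_GLOver (mem_plus_iff h hd) u, _, map_mem_GLOver (mem_minus_iff h hd) v,
    Units.ext huv⟩

end

end Birkhoff

end

theorem proposition1p2 (n : ℕ) :
    (∀ (A : Type*) [NormedCommRing A] [NormedAlgebra ℂ A] [CompleteSpace A]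
        (ι : A →ₐ[ℂ] C(Circle, ℂ)),
        Birkhoff.IsTypeR ι → Birkhoff.IsDecomposing ι →
          Birkhoff.HasBirkhoffFactorization n ι) ∧
    (∀ (A : Type*) [CommRing A] [Algebra ℂ A] [TopologicalSpace A] [Birkhoff.IsCIA A]
        (ι : A →ₐ[ℂ] C(Circle, ℂ)),
        Birkhoff.IsTypeR ι → Birkhoff.IsMackeyComplete A → Birkhoff.IsDecomposing ι →
          Birkhoff.ProductIsIdentityNhd n ι →
            Birkhoff.HasBirkhoffFactorization n ι) := by
  refine ⟨fun A _ _ _ ι h hd => ?_, fun A _ _ _ _ ι h _ hd hW => ?_⟩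
  · have := Birkhoff.isCIA_of_completeSpace A
    exact Birkhoff.hasBirkhoffFactorization h hd
      (Birkhoff.productIsIdentityNhd_of_completeSpace h hd)
  · exact Birkhoff.hasBirkhoffFactorization h hd hW
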